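/- Let $q$ be a power of a prime $p$, let $\beta\in\mathbb F_{q^2}$ be such that $\{\beta,\beta^q\}$ is a basis of $\mathbb F_{q^2}$ over $\mathbb F_q$, and let $\phi(\mathbf a|\mathbf b)=\beta\mathbf a+\beta^q\mathbf b$, a bijection $\mathbb F_q^{2n}\to\mathbb F_{q^2}^n$. *Conventions.* Let $X(\mathbf a)Z(\mathbf b)$, $(\mathbf a|\mathbf b)\in\mathbb F_q^{2n}$, be the generalized Pauli operators on $(\mathbb C^q)^{\otimes n}$, given by $X(\mathbf a)|\mathbf j\rangle=|\mathbf j+\mathbf a\rangle$ and $Z(\mathbf b)|\mathbf j\rangle=e^{2\pi i\,\mathrm{tr}(\mathbf b\cdot\mathbf j)/p}|\mathbf j\rangle$, where $\mathrm{tr}:\mathbb F_q\to\mathbb F_p$; they generate, with the $p$-th roots of unity ($p$ odd) or the fourth roots of unity ($p=2$) as phases, the group $\mathcal E_n$. Let $\tau(zX(\mathbf a)Z(\mathbf b))=(\mathbf a|\mathbf b)$, and let the weight be the number of qudits acted on nontrivially. A stabilizer group is an Abelian subgroup $\mathcal S\subseteq\mathcal E_n$ whose only scalar is $I$; it stabilizes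 the space $\mathcal Q$ of all states that it fixes. A code $\mathcal C\subseteq\mathbb F_{q^2}^n$ stabilizes $\mathcal Q$ if $\mathcal Q$ is stabilized by a stabilizer group $\mathcal S$ with $\tau(\mathcal S)=\phi^{-1}(\mathcal C)$. An $[[n,k,d]]_q$ code is a subspace of dimension $q^k$ of $(\mathbb C^q)^{\otimes n}$ that detects all Pauli errors of weight less than $d$ (that is, its minimum distance, the least weight of an undetectable error, is at least $d$); for $k=0$ one requires instead that non-identity errors of weight less than $d$ map the code to its orthogonal complement. The stabilizer code is pure (to $d$) if $\mathcal S$ has no non-identity element of weight less than $d$. An $[[n,k,d;c]]_q$ EAQECC with EA-stabilizer $\mathcal S'\subseteq\mathcal E_n$ is a $q^k$-dimensional subspace of the space of $n$ sender qudits and $c$ receiver qudits such that: (i) modulo scalars, the part $\mathcal S'_I$ of $\mathcal S'$ commuting with all of $\mathcal S'$ has size $q^l$ and $\mathcal S'$ has size $q^{l+2c}$, with $k=n-c-l$; (ii) it is stabilized by a stabilizer group in $\mathcal E_{n+c}$ whose restriction to the sender's qudits is $\mathcal S'$ up to phases; (iii) it is the set of states obtained from $k$ information qudits and the sender's halves of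 $c$ maximally entangled pairs by an isometry into the sender's $n$ qudits; (iv) errors on the sender's qudits of weight less than $d$ are detected, with the same convention if $k=0$; its minimum distance is the least weight of an undetectable error on the sender's qudits. It is equivalent to an $[[n+c,k,d]]_q$ code with stabilizer $\mathcal S$ if $\mathcal S'$ is obtained, up to phases, from $\mathcal S$ by puncturing some $c$ coordinates. **Lemma.** Let $\mathcal C$ be an $[N,u]_{q^2}$ linear code with $\mathcal C\subseteq\mathcal C^{\perp_h}$, where $\perp_h$ is the dual for $\sum_j x_jy_j^q$, and let $d$ be its dual distance, the minimum weight of a nonzero word of $\mathcal C^{\perp_h}$. Then there is a stabilizer group $\mathcal S$ with $\tau(\mathcal S)=\phi^{-1}(\mathcal C)$, and for every such $\mathcal S$, with $\mathcal Q$ the code it stabilizes: 1. $2u\le N$, and $\mathcal Q$ is an $[[N,N-2u,d]]_q$ code, pure to $d$. If some word of $\mathcal C^{\perp_h}\setminus\mathcal C$ has weight $d$, then the minimum distance of $\mathcal Q$ is exactly $d$. 2. For every $0<c\le u$ there are $c$ coordinates and an $[[N-c,N-2u,d;c]]_q$ EAQECC $\mathcal Q^{ea}$ whose EA-stabilizer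 $\mathcal S'$ is obtained from $\mathcal S$ by puncturing these coordinates; so $\tau(\mathcal S')=\phi^{-1}(\mathcal C')$ for the punctured code $\mathcal C'$, and $\mathcal Q^{ea}$ is equivalent to $\mathcal Q$. If some word of $\mathcal C^{\perp_h}\setminus\mathcal C$ has weight $d$, then the coordinates can be chosen so that $\mathcal Q^{ea}$ has minimum distance exactly $d$. -/

import Mathlib

open scoped Matrix

namespace EAQ

noncomputable section

/-! ### Classical codes over the quadratic extension -/

section Classical

variable (F : Type*) {K : Type*} [Field F] [Fintype F] [Field K] [Algebra F K]
variable {ι : Type*} [Fintype ι]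

/-- The Hermitian inner product `∑ j, x j * conj (y j)`, where `conj t = t ^ q` and `q = |F|`. -/
def hermInner (x y : ι → K) : K := ∑ j, x j * y j ^ Fintype.card F

/-- The Hermitian dual of a linear code. -/
def hermDual (C : Submodule K (ι → K)) : Submodule K (ι → K) where
  carrier := {x | ∀ y ∈ C, hermInner F x y = 0}
  add_mem' := by
    intro x x' hx hx' y hy
    have h1 := hx y hy
    have h2 := hx' y hy
    simp only [hermInner] at h1 h2 ⊢
    simp [add_mul, Finset.sum_add_distrib, h1, h2]
  zero_mem' := by
    intro y _
    simp [hermInner]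
  smul_mem' := by
    intro r x hx y hy
    have h1 := hx y hy
    simp only [hermInner] at h1 ⊢
    simp [mul_assoc, ← Finset.mul_sum, h1]

/-- `d` is the minimum Hamming weight of a nonzero word of the Hermitian dual of `C`. -/
def IsDualDistance [DecidableEq K] (C : Submodule K (ι → K)) (d : ℕ) : Prop :=
  IsLeast {w : ℕ | ∃ x ∈ hermDual F C, x ≠ 0 ∧ hammingNorm x = w} d

/-- The identification `(a|b) ↦ β a + β^q b` of `F^{2n}` with `K^n`. -/
def phi (β : K) (v : (ι → F) × (ι → F)) : ι → K :=
  fun i => β * algebraMap F K (v.1 i) + β ^ Fintype.card F * algebraMap F K (v.2 i)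

end Classical

/-! ### Generalized Pauli operators on `n` qudits

The state space of qudits indexed by `ι` is `((ι → F) → ℂ)`, with basis `|j⟩`, `j ∈ F^ι`, and
Hermitian form `star u ⬝ᵥ v`. -/

section Pauli

variable {F : Type*} [Field F] [Fintype F] [DecidableEq F] (p : ℕ) [Fact p.Prime]
  [Algebra (ZMod p) F]
variable {ι : Type*} [Fintype ι] [DecidableEq ι]

/-- The additive character `x ↦ ω ^ tr x` of `F`, where `ω = exp (2πi/p)`. -/
def chr : AddChar F ℂ :=
  (ZMod.stdAddChar (N := p)).compAddMonoidHom (Algebra.trace (ZMod p) F).toAddMonoidHom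

/-- `X(a)|j⟩ = |j + a⟩`. -/
def opX (a : ι → F) : Matrix (ι → F) (ι → F) ℂ :=
  Matrix.of fun i j => if i = j + a then 1 else 0

/-- `Z(b)|j⟩ = ω ^ tr(b · j) |j⟩`. -/
def opZ (b : ι → F) : Matrix (ι → F) (ι → F) ℂ :=
  Matrix.diagonal fun j => chr p (b ⬝ᵥ j)

/-- The operator `X(a) Z(b)`. -/
def pauli (v : (ι → F) × (ι → F)) : Matrix (ι → F) (ι → F) ℂ := opX v.1 * opZ p v.2

/-- The number of qudits on which `X(a) Z(b)` acts nontrivially. -/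
def swt (v : (ι → F) × (ι → F)) : ℕ :=
  (Finset.univ.filter fun i => v.1 i ≠ 0 ∨ v.2 i ≠ 0).card

/-- The phases allowed in the error group are the `p`-th roots of unity for odd `p`, and the
fourth roots of unity for `p = 2` (so that Hermitian operators such as `i X Z` are included). -/
def phaseOrder : ℕ := if p = 2 then 4 else p

theorem chr_pow (x : F) : chr p x ^ p = 1 := by
  rw [← AddChar.map_nsmul_eq_pow]
  have : p • x = 0 := by
    rw [← Nat.cast_smul_eq_nsmul (ZMod p)]
    simp
  rw [this, AddChar.map_zero_eq_one]

theorem chr_pow_phaseOrder (x : F) : chr p x ^ phaseOrder p = 1 := by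
  unfold phaseOrder
  split_ifs with h
  · have h2 := chr_pow p x
    have h4 : 4 = p * 2 := by omega
    rw [h4, pow_mul, h2, one_pow]
  · exact chr_pow p x

theorem phaseOrder_ne_zero : phaseOrder p ≠ 0 := by
  unfold phaseOrder
  split_ifs
  · norm_num
  · exact (Fact.out : p.Prime).ne_zero

theorem pauli_apply (v : (ι → F) × (ι → F)) (i j : ι → F) :
    pauli p v i j = if i = j + v.1 then chr p (v.2 ⬝ᵥ j) else 0 := by
  simp [pauli, opX, opZ, Matrix.mul_diagonal]

theorem pauli_zero : pauli p (0 : (ι → F) × (ι → F)) = 1 := by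
  ext i j
  simp [pauli_apply, Matrix.one_apply]

theorem pauli_mul (v w : (ι → F) × (ι → F)) :
    pauli p v * pauli p w = chr p (v.2 ⬝ᵥ w.1) • pauli p (v + w) := by
  ext i j
  simp only [Matrix.mul_apply, pauli_apply, Matrix.smul_apply, smul_eq_mul, Prod.fst_add,
    Prod.snd_add]
  rw [Finset.sum_eq_single (j + w.1)]
  · have e : i = j + w.1 + v.1 ↔ i = j + (v.1 + w.1) := by
      rw [add_assoc, add_comm w.1]
    by_cases h : i = j + (v.1 + w.1)
    · rw [if_pos (e.2 h), if_pos h, if_pos rfl, add_dotProduct, dotProduct_add,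
        AddChar.map_add_eq_mul, AddChar.map_add_eq_mul]
      ring
    · rw [if_neg (fun h' => h (e.1 h')), if_neg h]
      simp
  · intro k _ hk
    simp [hk]
  · simp

/-- The generalized Pauli group `{z X(a) Z(b)}` on the qudits indexed by `ι`. -/
def pauliGroup (F : Type*) [Field F] [Fintype F] [DecidableEq F] (p : ℕ) [Fact p.Prime]
    [Algebra (ZMod p) F] (ι : Type*) [Fintype ι] [DecidableEq ι] :
    Subgroup (Matrix (ι → F) (ι → F) ℂ)ˣ where
  carrier := {g | ∃ z : ℂ, z ^ phaseOrder p = 1 ∧ ∃ v : (ι → F) × (ι → F),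
    (g : Matrix (ι → F) (ι → F) ℂ) = z • pauli p v}
  mul_mem' := by
    rintro g h ⟨z, hz, v, hg⟩ ⟨z', hz', v', hh⟩
    refine ⟨z * z' * chr p (v.2 ⬝ᵥ v'.1), ?_, v + v', ?_⟩
    · rw [mul_pow, mul_pow, hz, hz', chr_pow_phaseOrder]
      simp
    · rw [Units.val_mul, hg, hh, Matrix.smul_mul, Matrix.mul_smul, pauli_mul, smul_smul, smul_smul]
  one_mem' := ⟨1, one_pow _, 0, by simp [pauli_zero]⟩
  inv_mem' := by
    rintro g ⟨z, hz, v, hg⟩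
    have hz0 : z ≠ 0 := by
      rintro rfl
      rw [zero_pow (phaseOrder_ne_zero p)] at hz
      exact zero_ne_one hz
    have hc0 : chr p (v.2 ⬝ᵥ (-v).1) ≠ 0 := by
      intro h0
      have h1 := chr_pow_phaseOrder p (v.2 ⬝ᵥ (-v).1)
      rw [h0, zero_pow (phaseOrder_ne_zero p)] at h1
      exact zero_ne_one h1
    refine ⟨z⁻¹ * (chr p (v.2 ⬝ᵥ (-v).1))⁻¹, ?_, -v, ?_⟩
    · rw [mul_pow, inv_pow, inv_pow, hz, chr_pow_phaseOrder]
      simp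
    · apply Units.inv_eq_of_mul_eq_one_right
      rw [hg, Matrix.smul_mul, Matrix.mul_smul, pauli_mul, smul_smul, smul_smul, add_neg_cancel,
        pauli_zero]
      have : z * (z⁻¹ * (chr p (v.2 ⬝ᵥ (-v).1))⁻¹) * chr p (v.2 ⬝ᵥ (-v).1) = 1 := by
        field_simp
      rw [this, one_smul]

/-- The image in `F^{2n}` of a group of Pauli operators, forgetting phases. -/
def tau (S : Subgroup (Matrix (ι → F) (ι → F) ℂ)ˣ) : Set ((ι → F) × (ι → F)) :=
  {v | ∃ g ∈ S, ∃ z : ℂ, z ^ phaseOrder p = 1 ∧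
    (g : Matrix (ι → F) (ι → F) ℂ) = z • pauli p v}

/-- The part `S_I` of a group of Pauli operators that commutes with the whole group. -/
def isotropicPart (S : Subgroup (Matrix (ι → F) (ι → F) ℂ)ˣ) :
    Subgroup (Matrix (ι → F) (ι → F) ℂ)ˣ :=
  S ⊓ Subgroup.centralizer (S : Set (Matrix (ι → F) (ι → F) ℂ)ˣ)

/-- An Abelian group of Pauli operators in which the identity is the only scalar. -/
structure IsStabilizerGroup (S : Subgroup (Matrix (ι → F) (ι → F) ℂ)ˣ) : Prop where
  le_pauli : S ≤ pauliGroup F p ι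
  comm : ∀ g ∈ S, ∀ h ∈ S, g * h = h * g
  no_scalar : ∀ g ∈ S, ∀ z : ℂ,
    (g : Matrix (ι → F) (ι → F) ℂ) = z • (1 : Matrix (ι → F) (ι → F) ℂ) → g = 1


/-- The space of states fixed by all operators of `S`. -/
def fixedSpace (S : Subgroup (Matrix (ι → F) (ι → F) ℂ)ˣ) : Submodule ℂ ((ι → F) → ℂ) where
  carrier := {x | ∀ g ∈ S, (g : Matrix (ι → F) (ι → F) ℂ) *ᵥ x = x}
  add_mem' := by
    intro x y hx hy g hg
    rw [Matrix.mulVec_add, hx g hg, hy g hg]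
  zero_mem' := by
    intro g _
    exact Matrix.mulVec_zero _
  smul_mem' := by
    intro r x hx g hg
    rw [Matrix.mulVec_smul, hx g hg]

/-- `E = X(a)Z(b)` is detectable by `Q`: `⟨x|E|y⟩ = l ⟨x|y⟩` on `Q` for a constant `l`. -/
def Detects (Q : Submodule ℂ ((ι → F) → ℂ)) (v : (ι → F) × (ι → F)) : Prop :=
  ∃ l : ℂ, ∀ x ∈ Q, ∀ y ∈ Q, star x ⬝ᵥ (pauli p v *ᵥ y) = l * (star x ⬝ᵥ y)

/-- The error `E = X(a)Z(b)` maps `Q` into the orthogonal complement of `Q`. -/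
def Annihilates (Q : Submodule ℂ ((ι → F) → ℂ)) (v : (ι → F) × (ι → F)) : Prop :=
  ∀ x ∈ Q, ∀ y ∈ Q, star x ⬝ᵥ (pauli p v *ᵥ y) = 0

/-- The minimum distance of a quantum code: the least weight of an undetectable Pauli error
(`⊤` if every error is detectable). -/
def qDist (Q : Submodule ℂ ((ι → F) → ℂ)) : ℕ∞ :=
  ⨅ v : (ι → F) × (ι → F), ⨅ _ : ¬ Detects p Q v, (swt v : ℕ∞)

/-- `Q` is an `[[n,k,d]]_q` code: a subspace of dimension `q ^ k` of the space of `n` qudits that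
detects every error of weight less than `d`. For `k = 0`, where detection is vacuous, the usual
convention is that nontrivial errors of weight less than `d` map the state to an
orthogonal one. -/
structure IsQECC (Q : Submodule ℂ ((ι → F) → ℂ)) (n k d : ℕ) : Prop where
  length : Fintype.card ι = n
  dim : Module.finrank ℂ Q = Fintype.card F ^ k
  dist : (d : ℕ∞) ≤ qDist p Q
  dist_zero : k = 0 → ∀ v : (ι → F) × (ι → F), v ≠ 0 → swt v < d → Annihilates p Q v

/-- The stabilizer `S` is pure to `d`: it has no nonscalar element of weight less than `d`. -/
def IsPureTo (S : Subgroup (Matrix (ι → F) (ι → F) ℂ)ˣ) (d : ℕ) : Prop :=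
  ∀ v ∈ tau p S, v ≠ 0 → d ≤ swt v

/-! ### Entanglement-assisted codes

The qudits indexed by `ι` belong to the sender and those indexed by `κ` to the receiver. -/

variable {κ : Type*} [Fintype κ] [DecidableEq κ]

/-- `S'` is obtained from `S`, up to phases, by keeping only the coordinates in the range
of `e`. -/
def IsPuncturing (e : ι → κ) (S : Subgroup (Matrix (κ → F) (κ → F) ℂ)ˣ)
    (S' : Subgroup (Matrix (ι → F) (ι → F) ℂ)ˣ) : Prop :=
  tau p S' = (fun v : (κ → F) × (κ → F) => (v.1 ∘ e, v.2 ∘ e)) '' tau p S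

/-- The error `E ⊗ I` for an error `E` on the sender's qudits. -/
def onSender (κ : Type*) (v : (ι → F) × (ι → F)) : (ι ⊕ κ → F) × (ι ⊕ κ → F) :=
  (Sum.elim v.1 0, Sum.elim v.2 0)

/-- The minimum distance of an entanglement-assisted code: the least weight of an undetectable
error on the sender's qudits, the receiver's halves of the ebits being free of errors. -/
def eaDist (Q : Submodule ℂ ((ι ⊕ κ → F) → ℂ)) : ℕ∞ :=
  ⨅ v : (ι → F) × (ι → F), ⨅ _ : ¬ Detects p Q (onSender κ v), (swt v : ℕ∞)

/-- `Q` consists of the states that the sender produces from `k` information qudits in state `ψ`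
and her halves of `|κ|` maximally entangled pairs by an isometry `W` (a unitary with
ancillas): up to normalization, these are the states `∑ m, W (ψ ⊗ |m⟩) ⊗ |m⟩`. -/
def IsEntanglementEncoded (Q : Submodule ℂ ((ι ⊕ κ → F) → ℂ)) (k : ℕ) : Prop :=
  ∃ W : (((Fin k → F) × (κ → F)) → ℂ) →ₗ[ℂ] ((ι → F) → ℂ),
    (∀ x y, star (W x) ⬝ᵥ W y = star x ⬝ᵥ y) ∧
    ∀ Ψ : (ι ⊕ κ → F) → ℂ, Ψ ∈ Q ↔ ∃ ψ : (Fin k → F) → ℂ, ∀ (j : ι → F) (m : κ → F),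
      Ψ (Sum.elim j m) = W (fun s => if s.2 = m then ψ s.1 else 0) j

/-- `Q` is an `[[n,k,d;c]]_q` entanglement-assisted code with EA-stabilizer `S`. -/
structure IsEAQECC (S : Subgroup (Matrix (ι → F) (ι → F) ℂ)ˣ)
    (Q : Submodule ℂ ((ι ⊕ κ → F) → ℂ)) (n k d c : ℕ) : Prop where
  length : Fintype.card ι = n
  ebits : Fintype.card κ = c
  le_pauli : S ≤ pauliGroup F p ι
  /-- Modulo scalars `|S_I| = q ^ l`, `|S / S_I| = q ^ (2c)`, and `k = n - c - l`. -/
  params : ∃ l : ℕ, (tau p (isotropicPart S)).ncard = Fintype.card F ^ l ∧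
    (tau p S).ncard = Fintype.card F ^ (l + 2 * c) ∧ k + c + l = n
  /-- `S` extends to an Abelian group on all the qudits, which stabilizes `Q`. -/
  extension : ∃ S₁ : Subgroup (Matrix (ι ⊕ κ → F) (ι ⊕ κ → F) ℂ)ˣ,
    IsStabilizerGroup p S₁ ∧ IsPuncturing p Sum.inl S₁ S ∧ Q = fixedSpace S₁
  encoded : IsEntanglementEncoded Q k
  dim : Module.finrank ℂ Q = Fintype.card F ^ k
  dist : (d : ℕ∞) ≤ eaDist p Q
  dist_zero : k = 0 → ∀ v : (ι → F) × (ι → F), v ≠ 0 → swt v < d →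
    Annihilates p Q (onSender κ v)

/-- The `[[n,k,d;c]]_q` code `Q'` with EA-stabilizer `S'` is equivalent to the `[[n+c,k,d]]_q`
code `Q` with stabilizer `S`: `S'` arises from `S` by puncturing the `c` coordinates in `T`. -/
structure IsEquivalentQECC (S : Subgroup (Matrix (ι → F) (ι → F) ℂ)ˣ)
    (Q : Submodule ℂ ((ι → F) → ℂ)) (T : Finset ι)
    (S' : Subgroup (Matrix ({i // i ∉ T} → F) ({i // i ∉ T} → F) ℂ)ˣ)
    (Q' : Submodule ℂ (({i // i ∉ T} ⊕ κ → F) → ℂ)) (n k d c : ℕ) : Prop where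
  stabilizer : IsStabilizerGroup p S
  code : Q = fixedSpace S
  qecc : IsQECC p Q (n + c) k d
  eaqecc : IsEAQECC p S' Q' n k d c
  card : T.card = c
  puncturing : IsPuncturing p (Subtype.val : {i // i ∉ T} → ι) S S'

end Pauli

end

end EAQ

open scoped Matrix
set_option linter.unusedSectionVars false
namespace EAQ

noncomputable section

/-! ### Commutation, traces and phases of Pauli operators; lifting labels to stabilizer groups. -/

section Pauli

variable {F : Type*} [Field F] [Fintype F] [DecidableEq F] (p : ℕ) [Fact p.Prime]
  [Algebra (ZMod p) F]
variable {ι : Type*} [Fintype ι] [DecidableEq ι]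

/-! Two Pauli operators commute exactly when the symplectic product of their labels has trace zero.
Through `phi`, that product is, up to a nonzero constant, the skew part of the Hermitian form. Since
`C` is linear over `K`, a label commutes with all labels of `C` iff its word lies in the Hermitian
dual (`phi_mem_hermDual_iff`). Self-orthogonality thus makes the labels of `C` commute, and a
character argument chooses phases so that they form a stabilizer group (`exists_isStabilizerGroup`).

The averaging projector of a stabilizer group has trace `q ^ N / |S|`, because nonscalar Pauli
operators are traceless; this gives the dimension. An error whose word is outside the dual maps the
code into its orthogonal complement, and one whose word is in the dual but not in `C` is
undetectable. Everything in part 1 then follows from the weights in the dual.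

For part 2, give the receiver a set `T` of `c` coordinates whose coordinate functionals are linearly
independent on `C`. Then no nonzero dual word is supported on `T`, so all nontrivial errors on the
receiver annihilate the code. Hence the receiver's state is maximally mixed and independent of the
encoded state, which produces the encoding isometry (`isEntanglementEncoded_of_annihilates`).
Puncturing at `T` preserves the dimension `u`, while the radical of the punctured code consists of
the punctured words of `C` that vanish on `T` and has dimension `u - c`; these are the required
sizes.

For the exact distance, `T` must avoid the support of a word `x` of weight `d` in the dual but not
in `C`. A nonzero word of `C` vanishing wherever `x` does could be used to make `x` lighter, so the
zeros of `x` contain an information set of `C`, in which `T` is chosen. -/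

theorem chr_ne_zero (x : F) : chr p x ≠ 0 := by
  intro h
  have := chr_pow_phaseOrder p x
  rw [h, zero_pow (phaseOrder_ne_zero p)] at this
  exact zero_ne_one this

theorem star_chr (x : F) : star (chr p x) = (chr p x)⁻¹ := by
  have h : ‖chr p x‖ = 1 := Complex.norm_eq_one_of_pow_eq_one (chr_pow_phaseOrder p x)
    (phaseOrder_ne_zero p)
  rw [Complex.inv_eq_conj h]
  rfl

/-- The trace form of the finite field is nondegenerate and the standard character of `ZMod p` is
faithful. -/
theorem exists_chr_mul_ne_one {x : F} (hx : x ≠ 0) : ∃ r : F, chr p (r * x) ≠ 1 := by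
  by_contra! h
  apply hx
  have := (traceForm_nondegenerate (ZMod p) F).2 x
  apply this
  intro r
  have h1 := h r
  rw [Algebra.traceForm_apply]
  have : ZMod.stdAddChar (N := p) (Algebra.trace (ZMod p) F (r * x)) = ZMod.stdAddChar (N := p) 0 := by
    rw [AddChar.map_zero_eq_one]
    exact h1
  exact ZMod.injective_stdAddChar this

theorem sum_chr_dotProduct (y : ι → F) :
    ∑ b : ι → F, chr p (b ⬝ᵥ y) = if y = 0 then (Fintype.card F : ℂ) ^ Fintype.card ι else 0 := by
  split_ifs with h
  · simp [h]
  · obtain ⟨i, hi⟩ := Function.ne_iff.1 h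
    obtain ⟨r, hr⟩ := exists_chr_mul_ne_one p hi
    let ψ : AddChar (ι → F) ℂ := (chr p).compAddMonoidHom
      ⟨⟨fun b => b ⬝ᵥ y, zero_dotProduct y⟩, fun a b => add_dotProduct a b y⟩
    change ∑ b, ψ b = 0
    rw [AddChar.sum_eq_zero_iff_ne_zero]
    rintro h0
    apply hr
    have : ψ (Pi.single i r) = 1 := by rw [h0]; rfl
    simpa [ψ] using this

theorem pauli_comm (v w : (ι → F) × (ι → F)) :
    pauli p v * pauli p w =
      (chr p (v.2 ⬝ᵥ w.1) * (chr p (w.2 ⬝ᵥ v.1))⁻¹) • (pauli p w * pauli p v) := by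
  rw [pauli_mul, pauli_mul, smul_smul, add_comm w v, mul_assoc, inv_mul_cancel₀ (chr_ne_zero p _),
    mul_one]

theorem pauli_ne_zero (v : (ι → F) × (ι → F)) : pauli p v ≠ 0 := by
  intro h
  have := congrFun (congrFun h v.1) 0
  simp [pauli_apply] at this

theorem trace_pauli (v : (ι → F) × (ι → F)) :
    (pauli p v).trace = if v = 0 then (Fintype.card F : ℂ) ^ Fintype.card ι else 0 := by
  obtain ⟨a, b⟩ := v
  simp only [Matrix.trace, Matrix.diag, pauli_apply]
  by_cases ha : a = 0
  · subst ha
    have := sum_chr_dotProduct p (ι := ι) b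
    simp only [add_zero, if_true, Prod.mk_eq_zero, true_and]
    rw [← this]
    simp_rw [dotProduct_comm]
  · simp [ha]

/-- Multiplying by the operator of label `-v` makes the left side scalar; if the labels differed,
the right side would have trace zero. -/
theorem smul_pauli_injective {z z' : ℂ} (hz : z ≠ 0) {v v' : (ι → F) × (ι → F)}
    (h : z • pauli p v = z' • pauli p v') : z = z' ∧ v = v' := by
  have h1 : v = v' := by
    by_contra hne
    have h2 : (z * chr p (v.2 ⬝ᵥ (-v).1)) • (1 : Matrix (ι → F) (ι → F) ℂ)
        = (z' * chr p (v'.2 ⬝ᵥ (-v).1)) • pauli p (v' + -v) := by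
      have := congrArg (· * pauli p (-v)) h
      simpa only [Matrix.smul_mul, pauli_mul, smul_smul, add_neg_cancel, pauli_zero] using this
    have h3 := congrArg Matrix.trace h2
    rw [← pauli_zero p, Matrix.trace_smul, Matrix.trace_smul, trace_pauli, trace_pauli, if_pos rfl,
      if_neg (by rw [← sub_eq_add_neg]; exact sub_ne_zero.2 (Ne.symm hne))] at h3
    simp [hz, chr_ne_zero] at h3
  subst h1
  exact ⟨smul_left_injective ℂ (pauli_ne_zero p v) h, rfl⟩

theorem conjTranspose_pauli (v : (ι → F) × (ι → F)) :
    (pauli p v)ᴴ = (chr p (v.2 ⬝ᵥ v.1)) • pauli p (-v) := by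
  ext i j
  simp only [Matrix.conjTranspose_apply, pauli_apply, Matrix.smul_apply, smul_eq_mul]
  have e : j = i + v.1 ↔ i = j + (-v).1 := by
    simp [eq_sub_iff_add_eq, ← sub_eq_add_neg, eq_comm]
  by_cases h : j = i + v.1
  · rw [if_pos h, if_pos (e.1 h), star_chr, ← AddChar.map_neg_eq_inv, ← AddChar.map_add_eq_mul, h]
    simp [dotProduct_add]
  · rw [if_neg h, if_neg (mt e.2 h)]
    simp

theorem pauli_unitary (v : (ι → F) × (ι → F)) : (pauli p v)ᴴ * pauli p v = 1 := by
  rw [conjTranspose_pauli, Matrix.smul_mul, pauli_mul, smul_smul, neg_add_cancel, pauli_zero,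
    ← AddChar.map_add_eq_mul]
  simp

theorem phase_ne_zero {z : ℂ} (hz : z ^ phaseOrder p = 1) : z ≠ 0 := by
  rintro rfl
  rw [zero_pow (phaseOrder_ne_zero p)] at hz
  exact zero_ne_one hz

theorem star_mul_phase {z : ℂ} (hz : z ^ phaseOrder p = 1) : star z * z = 1 := by
  have h : ‖z‖ = 1 := Complex.norm_eq_one_of_pow_eq_one hz (phaseOrder_ne_zero p)
  have := Complex.conj_mul' z
  rw [h] at this
  simpa using this

/-- `X(a)Z(b)` as an invertible matrix. -/
def pauliUnit (v : (ι → F) × (ι → F)) : (Matrix (ι → F) (ι → F) ℂ)ˣ where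
  val := pauli p v
  inv := (pauli p v)ᴴ
  val_inv := mul_eq_one_comm.1 (pauli_unitary p v)
  inv_val := pauli_unitary p v

theorem pauli_pow (v : (ι → F) × (ι → F)) (n : ℕ) :
    pauli p v ^ n = chr p ((n.choose 2) • (v.2 ⬝ᵥ v.1)) • pauli p (n • v) := by
  induction n with
  | zero => simp [pauli_zero]
  | succ n ih =>
    rw [pow_succ, ih, Matrix.smul_mul, pauli_mul, smul_smul, ← AddChar.map_add_eq_mul, succ_nsmul,
      Nat.choose_succ_succ' n 1]
    congr 3
    simp only [Prod.smul_snd, smul_dotProduct, add_smul, Nat.choose_one_right, add_comm]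

theorem nsmul_eq_zero_of_dvd {M : Type*} [AddCommGroup M] [Module F M] {n : ℕ} (h : p ∣ n) (x : M) :
    n • x = 0 := by
  obtain ⟨m, rfl⟩ := h
  rw [mul_comm, mul_smul, ← Nat.cast_smul_eq_nsmul F p]
  have : (p : F) = 0 := by
    rw [← map_natCast (algebraMap (ZMod p) F)]
    simp
  simp [this]

/-- The `n`-th power carries a phase with exponent `n.choose 2`. An odd `p` divides `p.choose 2`,
but `2.choose 2 = 1` is odd while `4.choose 2 = 6` is even: hence fourth roots of unity for `p = 2`.
-/
theorem pauli_pow_phaseOrder (v : (ι → F) × (ι → F)) : pauli p v ^ phaseOrder p = 1 := by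
  have hp : p.Prime := Fact.out
  rw [pauli_pow, nsmul_eq_zero_of_dvd (F := F) p, nsmul_eq_zero_of_dvd (F := F) p, pauli_zero]
  · simp
  · unfold phaseOrder
    split_ifs with h
    · subst h; decide
    · exact dvd_rfl
  · unfold phaseOrder
    split_ifs with h
    · subst h; decide
    · exact hp.dvd_choose_self two_ne_zero (lt_of_le_of_ne hp.two_le (Ne.symm h))

/-- Two labels commute if the corresponding Pauli operators do. -/
def Commutes (v w : (ι → F) × (ι → F)) : Prop := chr p (v.2 ⬝ᵥ w.1) = chr p (w.2 ⬝ᵥ v.1)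

theorem commutes_iff (v w : (ι → F) × (ι → F)) :
    Commutes p v w ↔ pauli p v * pauli p w = pauli p w * pauli p v := by
  rw [Commutes, pauli_mul, pauli_mul, add_comm w v]
  exact ⟨fun h => by rw [h], fun h => smul_left_injective ℂ (pauli_ne_zero p _) h⟩

/-- The group of all Pauli operators, with arbitrary phases, whose label lies in `D`. -/
def pauliPreimage (D : AddSubgroup ((ι → F) × (ι → F))) :
    Subgroup (Matrix (ι → F) (ι → F) ℂ)ˣ where
  carrier := {g | ∃ z : ℂ, z ^ phaseOrder p = 1 ∧ ∃ v ∈ D,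
    (g : Matrix (ι → F) (ι → F) ℂ) = z • pauli p v}
  mul_mem' := by
    rintro g h ⟨z, hz, v, hv, hg⟩ ⟨z', hz', v', hv', hh⟩
    refine ⟨z * z' * chr p (v.2 ⬝ᵥ v'.1), ?_, v + v', D.add_mem hv hv', ?_⟩
    · rw [mul_pow, mul_pow, hz, hz', chr_pow_phaseOrder]
      simp
    · rw [Units.val_mul, hg, hh, Matrix.smul_mul, Matrix.mul_smul, pauli_mul, smul_smul, smul_smul]
  one_mem' := ⟨1, one_pow _, 0, D.zero_mem, by simp [pauli_zero]⟩
  inv_mem' := by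
    rintro g ⟨z, hz, v, hv, hg⟩
    obtain ⟨z', hz', v', hg'⟩ := (pauliGroup F p ι).inv_mem ⟨z, hz, v, hg⟩
    have h1 : (g : Matrix (ι → F) (ι → F) ℂ) * (g⁻¹ : (Matrix (ι → F) (ι → F) ℂ)ˣ) = 1 :=
      Units.mul_inv g
    rw [hg, hg', Matrix.smul_mul, Matrix.mul_smul, pauli_mul, smul_smul, smul_smul,
      ← pauli_zero p, ← one_smul ℂ (pauli p 0)] at h1
    have h2 := (smul_pauli_injective p (mul_ne_zero (mul_ne_zero (phase_ne_zero p hz)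
      (phase_ne_zero p hz')) (chr_ne_zero p _)) h1).2
    refine ⟨z', hz', v', ?_, hg'⟩
    rw [eq_neg_of_add_eq_zero_right h2]
    exact D.neg_mem hv

theorem tau_pauliPreimage (D : AddSubgroup ((ι → F) × (ι → F))) :
    tau p (pauliPreimage p D) = D := by
  ext v
  constructor
  · rintro ⟨g, ⟨z, hz, w, hw, hg⟩, z', hz', hg'⟩
    rw [hg] at hg'
    rw [← (smul_pauli_injective p (phase_ne_zero p hz) hg').2]
    exact hw
  · intro hv
    exact ⟨pauliUnit p v, ⟨1, one_pow _, v, hv, by simp [pauliUnit]⟩, 1, one_pow _,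
      by simp [pauliUnit]⟩

theorem pauliPreimage_le (D : AddSubgroup ((ι → F) × (ι → F))) :
    pauliPreimage p D ≤ pauliGroup F p ι := by
  rintro g ⟨z, hz, v, -, hg⟩
  exact ⟨z, hz, v, hg⟩

theorem smul_pauli_comm_iff {z z' : ℂ} (hz : z ≠ 0) (hz' : z' ≠ 0) (v w : (ι → F) × (ι → F)) :
    (z • pauli p v) * (z' • pauli p w) = (z' • pauli p w) * (z • pauli p v) ↔ Commutes p v w := by
  rw [commutes_iff, Matrix.smul_mul, Matrix.mul_smul, Matrix.smul_mul, Matrix.mul_smul, smul_smul,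
    smul_smul, mul_comm z' z]
  exact ⟨fun h => smul_right_injective _ (mul_ne_zero hz hz') h, fun h => by rw [h]⟩

theorem tau_isotropicPart_pauliPreimage (D : AddSubgroup ((ι → F) × (ι → F))) :
    tau p (isotropicPart (pauliPreimage p D)) = {v | v ∈ D ∧ ∀ w ∈ D, Commutes p v w} := by
  ext v
  constructor
  · rintro ⟨g, ⟨hg, hgc⟩, z, hz, hgz⟩
    refine ⟨?_, fun w hw => ?_⟩
    · have : v ∈ tau p (pauliPreimage p D) := ⟨g, hg, z, hz, hgz⟩
      rwa [tau_pauliPreimage] at this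
    · have h := Subgroup.mem_centralizer_iff.1 hgc (pauliUnit p w)
        ⟨1, one_pow _, w, hw, by simp [pauliUnit]⟩
      have h := congrArg Units.val h
      simp only [Units.val_mul, hgz] at h
      rw [← smul_pauli_comm_iff p (phase_ne_zero p hz) one_ne_zero, one_smul]
      exact h.symm
  · rintro ⟨hv, hc⟩
    refine ⟨pauliUnit p v, ⟨⟨1, one_pow _, v, hv, by simp [pauliUnit]⟩, ?_⟩, 1, one_pow _,
      by simp [pauliUnit]⟩
    refine Subgroup.mem_centralizer_iff.2 ?_
    rintro h ⟨z, hz, w, hw, hh⟩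
    apply Units.ext
    have := (smul_pauli_comm_iff p one_ne_zero (phase_ne_zero p hz) v w).2 (hc w hw)
    rw [one_smul] at this
    simp only [Units.val_mul, hh]
    exact this.symm

theorem pauliPreimage_comm {D : AddSubgroup ((ι → F) × (ι → F))}
    (hD : ∀ v ∈ D, ∀ w ∈ D, Commutes p v w) (g : (Matrix (ι → F) (ι → F) ℂ)ˣ)
    (hg : g ∈ pauliPreimage p D) (h : (Matrix (ι → F) (ι → F) ℂ)ˣ) (hh : h ∈ pauliPreimage p D) :
    g * h = h * g := by
  obtain ⟨z, hz, v, hv, hg⟩ := hg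
  obtain ⟨z', hz', v', hv', hh⟩ := hh
  apply Units.ext
  rw [Units.val_mul, Units.val_mul, hg, hh]
  exact (smul_pauli_comm_iff p (phase_ne_zero p hz) (phase_ne_zero p hz') v v').2 (hD v hv v' hv')

theorem finite_pauliGroup : (pauliGroup F p ι : Set (Matrix (ι → F) (ι → F) ℂ)ˣ).Finite := by
  have hz : {z : ℂ | z ^ phaseOrder p = 1}.Finite := by
    have := (Polynomial.nthRootsFinset (phaseOrder p) (1 : ℂ)).finite_toSet
    refine this.subset fun z hz => ?_
    exact (Polynomial.mem_nthRootsFinset (Nat.pos_of_ne_zero (phaseOrder_ne_zero p)) (1 : ℂ)).2 hz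
  have := (hz.prod (Set.finite_univ (α := (ι → F) × (ι → F)))).image
    fun a : ℂ × ((ι → F) × (ι → F)) => a.1 • pauli p a.2
  refine (this.preimage (Units.val_injective.injOn)).subset ?_
  rintro g ⟨z, hz, v, hg⟩
  exact ⟨(z, v), ⟨hz, trivial⟩, hg.symm⟩

/-- Every commuting set of labels is the label set of a stabilizer group. -/
theorem exists_isStabilizerGroup {D : AddSubgroup ((ι → F) × (ι → F))}
    (hD : ∀ v ∈ D, ∀ w ∈ D, Commutes p v w) :
    ∃ S : Subgroup (Matrix (ι → F) (ι → F) ℂ)ˣ, IsStabilizerGroup p S ∧ tau p S = D := by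
  let G := pauliPreimage p D
  let _ : CommGroup G :=
    { (inferInstance : Group G) with
      mul_comm := fun g h => Subtype.ext (pauliPreimage_comm p hD g g.2 h h.2) }
  have : Finite G := ((finite_pauliGroup (F := F) (ι := ι) p).subset (pauliPreimage_le p D)).to_subtype
  let M : Subgroup G :=
    { carrier := {g | ∃ z : ℂ, (g.1 : Matrix (ι → F) (ι → F) ℂ) = z • 1}
      mul_mem' := by
        rintro g h ⟨z, hg⟩ ⟨z', hh⟩
        exact ⟨z * z', by
          change (g.1 : Matrix (ι → F) (ι → F) ℂ) * (h.1 : Matrix (ι → F) (ι → F) ℂ) = _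
          rw [hg, hh, Matrix.smul_mul, one_mul, smul_smul]⟩
      one_mem' := ⟨1, by rw [one_smul]; rfl⟩
      inv_mem' := by
        rintro g ⟨z, hg⟩
        have h1 : (g.1 : Matrix (ι → F) (ι → F) ℂ) *
          (g.1⁻¹ : (Matrix (ι → F) (ι → F) ℂ)ˣ) = 1 := Units.mul_inv g.1
        rw [hg, Matrix.smul_mul, one_mul] at h1
        have hz : z ≠ 0 := by rintro rfl; rw [zero_smul] at h1; exact zero_ne_one h1
        refine ⟨z⁻¹, ?_⟩
        change ((g.1⁻¹ : (Matrix (ι → F) (ι → F) ℂ)ˣ) : Matrix (ι → F) (ι → F) ℂ) = _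
        rw [← h1, smul_smul, inv_mul_cancel₀ hz, one_smul] }
  let χ₀ : M →* ℂ :=
    { toFun := fun g => (g.1.1 : Matrix (ι → F) (ι → F) ℂ) 0 0
      map_one' := by
        change (1 : Matrix (ι → F) (ι → F) ℂ) 0 0 = 1
        simp
      map_mul' := by
        rintro ⟨g, z, hg⟩ ⟨h, z', hh⟩
        change ((g.1 : Matrix (ι → F) (ι → F) ℂ) * (h.1 : Matrix (ι → F) (ι → F) ℂ)) 0 0 =
          (g.1 : Matrix (ι → F) (ι → F) ℂ) 0 0 * (h.1 : Matrix (ι → F) (ι → F) ℂ) 0 0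
        rw [hg, hh]
        simp [mul_comm] }
  have : NeZero (Monoid.exponent G : ℂ) := ⟨Nat.cast_ne_zero.2 Monoid.exponent_ne_zero_of_finite⟩
  -- A character of a subgroup of a finite abelian group extends to the whole group. Since `χ` sends
  -- each scalar to itself, its kernel contains no scalar but the identity.
  obtain ⟨χ, hχ⟩ := MonoidHom.domRestrict_surjective ℂ M χ₀.toHomUnits
  have hχM : ∀ (g : G) (z : ℂ), (g.1 : Matrix (ι → F) (ι → F) ℂ) = z • 1 → (χ g : ℂ) = z := by
    intro g z hg
    have h1 : χ g = χ₀.toHomUnits ⟨g, z, hg⟩ := by rw [← hχ]; rfl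
    rw [h1]
    change (g.1 : Matrix (ι → F) (ι → F) ℂ) 0 0 = z
    rw [hg]; simp
  have hsub : ∀ g ∈ χ.ker.map G.subtype, g ∈ pauliPreimage p D := by
    rintro _ ⟨g, -, rfl⟩
    exact g.2
  refine ⟨χ.ker.map G.subtype, ⟨?_, ?_, ?_⟩, ?_⟩
  · intro g hg
    exact pauliPreimage_le p D (hsub g hg)
  · intro g hg h hh
    exact pauliPreimage_comm p hD g (hsub g hg) h (hsub h hh)
  · rintro _ ⟨g, hg, rfl⟩ z hz
    have h1 := hχM g z hz
    have h2 : χ g = 1 := hg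
    rw [h2] at h1
    apply Units.ext
    rw [hz, ← h1]
    simp
  · ext v
    constructor
    · rintro ⟨g, hg, z, hz, hgz⟩
      rw [← tau_pauliPreimage p D]
      exact ⟨g, hsub g hg, z, hz, hgz⟩
    · intro hv
      have hmem : pauliUnit p v ∈ pauliPreimage p D :=
        ⟨1, one_pow _, v, hv, by simp [pauliUnit]⟩
      -- The value of `χ` is an admissible phase, so dividing the operator by it stays in the group
      -- and lands in the kernel; every label of `D` thus survives.
      have hpow : χ ⟨pauliUnit p v, hmem⟩ ^ phaseOrder p = 1 := by
        rw [← map_pow, ← map_one χ]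
        congr 1
        apply Subtype.ext
        apply Units.ext
        change pauli p v ^ phaseOrder p = 1
        exact pauli_pow_phaseOrder p v
      have hpow' : (χ ⟨pauliUnit p v, hmem⟩ : ℂ) ^ phaseOrder p = 1 := by
        rw [← Units.val_pow_eq_pow_val, hpow]; rfl
      set t := χ ⟨pauliUnit p v, hmem⟩ with ht
      have hinv : ((t⁻¹ : ℂˣ) : ℂ) ^ phaseOrder p = 1 := by
        rw [← Units.val_pow_eq_pow_val, inv_pow, hpow]; simp
      let s : (Matrix (ι → F) (ι → F) ℂ)ˣ := Units.map (algebraMap ℂ _).toMonoidHom t⁻¹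
      have hsv : (s : Matrix (ι → F) (ι → F) ℂ) = ((t⁻¹ : ℂˣ) : ℂ) • 1 :=
        Algebra.algebraMap_eq_smul_one _
      have hs : s ∈ pauliPreimage p D := ⟨_, hinv, 0, D.zero_mem, by rw [pauli_zero]; exact hsv⟩
      have hker : (⟨s, hs⟩ * ⟨pauliUnit p v, hmem⟩ : G) ∈ χ.ker := by
        have h1 : χ ⟨s, hs⟩ = t⁻¹ := Units.ext (hχM ⟨s, hs⟩ _ hsv)
        rw [MonoidHom.mem_ker, map_mul, h1, ht, inv_mul_cancel]
      refine ⟨s * pauliUnit p v, Subgroup.mem_map_of_mem G.subtype hker, _, hinv, ?_⟩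
      rw [Units.val_mul, hsv, Matrix.smul_mul, one_mul]
      rfl

end Pauli

/-! ### Dimension of a stabilizer code and its detectable errors. -/

section Codes

variable {F : Type*} [Field F] [Fintype F] [DecidableEq F] {p : ℕ} [Fact p.Prime]
  [Algebra (ZMod p) F]
variable {ι : Type*} [Fintype ι] [DecidableEq ι]
variable {S : Subgroup (Matrix (ι → F) (ι → F) ℂ)ˣ}

theorem IsStabilizerGroup.exists_eq (hS : IsStabilizerGroup p S)
    {g : (Matrix (ι → F) (ι → F) ℂ)ˣ} (hg : g ∈ S) :
    ∃ v ∈ tau p S, ∃ z : ℂ, z ^ phaseOrder p = 1 ∧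
      (g : Matrix (ι → F) (ι → F) ℂ) = z • pauli p v := by
  obtain ⟨z, hz, v, hv⟩ := hS.le_pauli hg
  exact ⟨v, ⟨g, hg, z, hz, hv⟩, z, hz, hv⟩

theorem IsStabilizerGroup.eq_of_label_eq (hS : IsStabilizerGroup p S)
    {g h : (Matrix (ι → F) (ι → F) ℂ)ˣ} (hg : g ∈ S) (hh : h ∈ S) {z z' : ℂ}
    (hz' : z' ≠ 0) {v : (ι → F) × (ι → F)}
    (hgz : (g : Matrix (ι → F) (ι → F) ℂ) = z • pauli p v)
    (hhz : (h : Matrix (ι → F) (ι → F) ℂ) = z' • pauli p v) : g = h := by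
  rw [← mul_inv_eq_one]
  refine hS.no_scalar _ (S.mul_mem hg (S.inv_mem hh)) (z * z'⁻¹) ?_
  have h1 : (g : Matrix (ι → F) (ι → F) ℂ) = (z * z'⁻¹) • (h : Matrix (ι → F) (ι → F) ℂ) := by
    rw [hgz, hhz, smul_smul, mul_assoc, inv_mul_cancel₀ hz', mul_one]
  rw [Units.val_mul, h1, Matrix.smul_mul, Units.mul_inv]

theorem IsStabilizerGroup.card_eq (hS : IsStabilizerGroup p S) :
    Nat.card S = (tau p S).ncard := by
  choose f hf z hz hfz using fun g : S => hS.exists_eq g.2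
  rw [← Nat.card_coe_set_eq]
  refine Nat.card_congr (Equiv.ofBijective (fun g => (⟨f g, hf g⟩ : tau p S)) ⟨?_, ?_⟩)
  · intro g h hgh
    have h1 : f g = f h := congrArg Subtype.val hgh
    refine Subtype.ext (hS.eq_of_label_eq g.2 h.2 (phase_ne_zero p (hz h)) (hfz g) ?_)
    rw [h1]
    exact hfz h
  · rintro ⟨v, g, hg, z', hz', hgv⟩
    refine ⟨⟨g, hg⟩, Subtype.ext ?_⟩
    exact (smul_pauli_injective p (phase_ne_zero p (hz ⟨g, hg⟩))
      ((hfz ⟨g, hg⟩).symm.trans hgv)).2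

theorem IsStabilizerGroup.finite (hS : IsStabilizerGroup p S) : Finite S :=
  ((finite_pauliGroup (F := F) (ι := ι) p).subset hS.le_pauli).to_subtype

variable (S) in
/-- The orthogonal projection onto the space fixed by a finite group of matrices. -/
def projector [Fintype S] : Matrix (ι → F) (ι → F) ℂ :=
  (Fintype.card S : ℂ)⁻¹ • ∑ g : S, (g.1 : Matrix (ι → F) (ι → F) ℂ)

theorem projector_mulVec_mem [Fintype S] (x : (ι → F) → ℂ) :
    projector S *ᵥ x ∈ fixedSpace S := by
  intro h hh
  rw [projector, Matrix.mulVec_mulVec, Matrix.mul_smul, Finset.mul_sum]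
  congr 2
  exact Fintype.sum_equiv (Equiv.mulLeft (⟨h, hh⟩ : S)) _ _ fun g => rfl

theorem projector_mulVec_of_mem [Fintype S] {x : (ι → F) → ℂ} (hx : x ∈ fixedSpace S) :
    projector S *ᵥ x = x := by
  rw [projector, Matrix.smul_mulVec, Matrix.sum_mulVec,
    Finset.sum_congr rfl (fun g _ => hx g.1 g.2)]
  rw [Finset.sum_const, Finset.card_univ, ← Nat.cast_smul_eq_nsmul ℂ, smul_smul,
    inv_mul_cancel₀ (Nat.cast_ne_zero.2 Fintype.card_ne_zero), one_smul]

theorem isProj_projector [Fintype S] :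
    LinearMap.IsProj (fixedSpace S) (Matrix.toLin' (projector S)) where
  map_mem x := by rw [Matrix.toLin'_apply]; exact projector_mulVec_mem x
  map_id x hx := by rw [Matrix.toLin'_apply]; exact projector_mulVec_of_mem hx

theorem trace_projector [Fintype S] :
    (projector S).trace = Module.finrank ℂ (fixedSpace S) := by
  rw [← isProj_projector.trace, Matrix.trace_toLin'_eq]

/-- Only scalar Pauli operators have nonzero trace, and the identity is the only scalar in `S`. -/
theorem IsStabilizerGroup.trace_projector [Fintype S] (hS : IsStabilizerGroup p S) :
    (projector S).trace =
      (Fintype.card S : ℂ)⁻¹ * (Fintype.card F : ℂ) ^ Fintype.card ι := by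
  rw [projector, Matrix.trace_smul, Matrix.trace_sum, smul_eq_mul, Finset.sum_eq_single 1]
  · congr 1
    rw [OneMemClass.coe_one, Units.val_one, ← pauli_zero p, trace_pauli, if_pos rfl]
  · rintro ⟨g, hg⟩ - hne
    obtain ⟨v, -, z, hz, hgz⟩ := hS.exists_eq hg
    rw [hgz, Matrix.trace_smul, trace_pauli, if_neg, smul_zero]
    rintro rfl
    rw [pauli_zero] at hgz
    exact hne (Subtype.ext (hS.no_scalar g hg z hgz))
  · simp

theorem IsStabilizerGroup.finrank_mul (hS : IsStabilizerGroup p S) :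
    Module.finrank ℂ (fixedSpace S) * (tau p S).ncard = Fintype.card F ^ Fintype.card ι := by
  have := hS.finite
  have := Fintype.ofFinite S
  rw [← hS.card_eq, Nat.card_eq_fintype_card]
  have h := EAQ.trace_projector (S := S)
  rw [hS.trace_projector] at h
  have h0 : (Fintype.card S : ℂ) ≠ 0 := Nat.cast_ne_zero.2 Fintype.card_ne_zero
  have : ((Module.finrank ℂ (fixedSpace S) * Fintype.card S : ℕ) : ℂ) =
      ((Fintype.card F ^ Fintype.card ι : ℕ) : ℂ) := by
    push_cast
    rw [← h]
    field_simp
  exact_mod_cast this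

theorem IsStabilizerGroup.finrank_ne_zero (hS : IsStabilizerGroup p S) :
    Module.finrank ℂ (fixedSpace S) ≠ 0 := by
  intro h
  have := hS.finrank_mul
  rw [h, zero_mul] at this
  exact (pow_ne_zero _ Fintype.card_ne_zero) this.symm

/-- An error that fails to commute with some element of the stabilizer maps the code into its
orthogonal complement. -/
theorem annihilates_of_not_commutes {v w : (ι → F) × (ι → F)} (hw : w ∈ tau p S)
    (hvw : ¬ Commutes p v w) : Annihilates p (fixedSpace S) v := by
  obtain ⟨g, hg, z, hz, hgz⟩ := hw
  intro x hx y hy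
  have hgx := hx g hg
  have hgy := hy g hg
  have hgg : (g : Matrix (ι → F) (ι → F) ℂ)ᴴ * (g : Matrix (ι → F) (ι → F) ℂ) = 1 := by
    rw [hgz, Matrix.conjTranspose_smul, Matrix.smul_mul, Matrix.mul_smul, pauli_unitary,
      smul_smul, star_mul_phase p hz, one_smul]
  have hcomm : pauli p v * (g : Matrix (ι → F) (ι → F) ℂ) =
      (chr p (v.2 ⬝ᵥ w.1) * (chr p (w.2 ⬝ᵥ v.1))⁻¹) •
        ((g : Matrix (ι → F) (ι → F) ℂ) * pauli p v) := by
    rw [hgz, Matrix.mul_smul, pauli_comm, Matrix.smul_mul, smul_smul, smul_smul, mul_comm]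
  set ω := chr p (v.2 ⬝ᵥ w.1) * (chr p (w.2 ⬝ᵥ v.1))⁻¹ with hω
  have hω1 : ω ≠ 1 := by
    intro h
    apply hvw
    rwa [hω, mul_inv_eq_one₀ (chr_ne_zero p _)] at h
  -- Replace `x` and `y` by their images under `g`, which fixes both, and move `g` past the error at
  -- the cost of `ω ≠ 1`.
  have key : star x ⬝ᵥ (pauli p v *ᵥ y) = ω * (star x ⬝ᵥ (pauli p v *ᵥ y)) := by
    conv_lhs => rw [← hgx, ← hgy]
    rw [Matrix.star_mulVec, ← Matrix.dotProduct_mulVec, Matrix.mulVec_mulVec,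
      Matrix.mulVec_mulVec, Matrix.mul_assoc, hcomm, Matrix.mul_smul, ← Matrix.mul_assoc, hgg, Matrix.one_mul,
      Matrix.smul_mulVec, dotProduct_smul, smul_eq_mul]
  have h2 : (ω - 1) * (star x ⬝ᵥ (pauli p v *ᵥ y)) = 0 := by
    rw [sub_mul, one_mul, ← key, sub_self]
  exact (mul_eq_zero.1 h2).resolve_left (sub_ne_zero.2 hω1)

theorem Annihilates.detects {Q : Submodule ℂ ((ι → F) → ℂ)} {v : (ι → F) × (ι → F)}
    (h : Annihilates p Q v) : Detects p Q v :=
  ⟨0, fun x hx y hy => by rw [h x hx y hy, zero_mul]⟩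

theorem detects_zero (Q : Submodule ℂ ((ι → F) → ℂ)) : Detects p Q 0 :=
  ⟨1, fun x _ y _ => by rw [pauli_zero, Matrix.one_mulVec, one_mul]⟩

open scoped ComplexOrder in
/-- An error that commutes with the stabilizer but does not belong to it is undetectable. -/
theorem IsStabilizerGroup.not_detects (hS : IsStabilizerGroup p S) {v : (ι → F) × (ι → F)}
    (hv : v ∉ tau p S) (hc : ∀ w ∈ tau p S, Commutes p v w) :
    ¬ Detects p (fixedSpace S) v := by
  have := hS.finite
  have := Fintype.ofFinite S
  rintro ⟨l, hl⟩
  have hE : ∀ y ∈ fixedSpace S, pauli p v *ᵥ y ∈ fixedSpace S := by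
    intro y hy g hg
    obtain ⟨w, hw, z, hz, hgz⟩ := hS.exists_eq hg
    have := (smul_pauli_comm_iff p one_ne_zero (phase_ne_zero p hz) v w).2 (hc w hw)
    rw [one_smul, ← hgz] at this
    rw [Matrix.mulVec_mulVec, ← this, ← Matrix.mulVec_mulVec, hy g hg]
  have hEl : ∀ y ∈ fixedSpace S, pauli p v *ᵥ y = l • y := by
    intro y hy
    -- The error preserves the code, so this difference lies in the code and detectability makes it
    -- orthogonal to itself.
    have hmem : pauli p v *ᵥ y - l • y ∈ fixedSpace S :=
      Submodule.sub_mem _ (hE y hy) (Submodule.smul_mem _ _ hy)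
    have h1 := hl _ hmem y hy
    rw [← sub_eq_zero, ← smul_eq_mul, ← dotProduct_smul, ← dotProduct_sub] at h1
    exact sub_eq_zero.1 (dotProduct_star_self_eq_zero.1 h1)
  have hEP : pauli p v * projector S = l • projector S := by
    apply Matrix.toLin'.injective
    ext1 x
    ext1
    simp only [LinearMap.comp_apply, Matrix.toLin'_apply]
    rw [← Matrix.mulVec_mulVec, hEl _ (projector_mulVec_mem _), Matrix.smul_mulVec]
  -- No product of the error with an element of `S` is scalar, since otherwise `v` would be a label
  -- of an inverse in `S`. So the left side has trace zero and `l = 0`; a unitary error then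
  -- annihilates a nonzero space.
  have htr := congrArg Matrix.trace hEP
  have h0 : (pauli p v * projector S).trace = 0 := by
    rw [projector, Matrix.mul_smul, Matrix.trace_smul, Finset.mul_sum, Matrix.trace_sum,
      Finset.sum_eq_zero, smul_zero]
    rintro ⟨g, hg⟩ -
    obtain ⟨w, hw, z, hz, hgz⟩ := hS.exists_eq (S.inv_mem hg)
    obtain ⟨w', hw', z', hz', hgz'⟩ := hS.exists_eq hg
    have h1 : (g : Matrix (ι → F) (ι → F) ℂ) *
      (g⁻¹ : (Matrix (ι → F) (ι → F) ℂ)ˣ) = 1 := Units.mul_inv g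
    rw [hgz, hgz', Matrix.smul_mul, Matrix.mul_smul, pauli_mul, smul_smul, smul_smul,
      ← pauli_zero p, ← one_smul ℂ (pauli p 0)] at h1
    have h2 := (smul_pauli_injective p (mul_ne_zero (mul_ne_zero (phase_ne_zero p hz')
      (phase_ne_zero p hz)) (chr_ne_zero p _)) h1).2
    rw [hgz', Matrix.mul_smul, pauli_mul, smul_smul, Matrix.trace_smul, trace_pauli, if_neg,
      smul_zero]
    intro h3
    apply hv
    rwa [add_right_cancel (h3.trans h2.symm |>.trans (add_comm w' w))]
  rw [h0, Matrix.trace_smul, EAQ.trace_projector, smul_eq_mul] at htr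
  have hl0 : l = 0 := (mul_eq_zero.1 htr.symm).resolve_right
    (Nat.cast_ne_zero.2 hS.finrank_ne_zero)
  apply hS.finrank_ne_zero
  have hbot : fixedSpace S = ⊥ := by
    rw [Submodule.eq_bot_iff]
    intro y hy
    have h1 := hEl y hy
    rw [hl0, zero_smul] at h1
    rw [← Matrix.one_mulVec y, ← pauli_unitary p v, ← Matrix.mulVec_mulVec, h1,
      Matrix.mulVec_zero]
  rw [hbot, finrank_bot]

end Codes

/-! ### From a maximally mixed receiver to an encoding isometry. -/

section Encoding

variable {F : Type*} [Field F] [Fintype F] [DecidableEq F] {p : ℕ} [Fact p.Prime]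
  [Algebra (ZMod p) F]
variable {ι κ : Type*} [Fintype ι] [DecidableEq ι] [Fintype κ] [DecidableEq κ]

theorem dotProduct_pauli_mulVec (x y : (ι → F) → ℂ) (v : (ι → F) × (ι → F)) :
    star x ⬝ᵥ (pauli p v *ᵥ y) = ∑ i, star (x (i + v.1)) * (chr p (v.2 ⬝ᵥ i) * y i) := by
  simp only [dotProduct, Matrix.mulVec, pauli_apply, Finset.mul_sum, ite_mul, zero_mul, mul_ite,
    mul_zero]
  rw [Finset.sum_comm]
  simp [Pi.star_apply]

theorem sum_sumElim {M : Type*} [AddCommMonoid M] (f : (ι ⊕ κ → F) → M) :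
    ∑ i, f i = ∑ j : ι → F, ∑ m : κ → F, f (Sum.elim j m) := by
  rw [← Fintype.sum_prod_type' (fun j m => f (Sum.elim j m))]
  exact Fintype.sum_equiv (Equiv.sumArrowEquivProdArrow ι κ F) _ _ fun i => by
    simp [Equiv.sumArrowEquivProdArrow]

/-- The error `I ⊗ E` for an error `E` on the receiver's qudits. -/
def onReceiver (ι : Type*) (v : (κ → F) × (κ → F)) : (ι ⊕ κ → F) × (ι ⊕ κ → F) :=
  (Sum.elim 0 v.1, Sum.elim 0 v.2)

theorem dotProduct_onReceiver (x y : (ι ⊕ κ → F) → ℂ) (v : (κ → F) × (κ → F)) :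
    star x ⬝ᵥ (pauli p (onReceiver ι v) *ᵥ y) =
      ∑ j : ι → F, ∑ m : κ → F,
        star (x (Sum.elim j (m + v.1))) * (chr p (v.2 ⬝ᵥ m) * y (Sum.elim j m)) := by
  rw [dotProduct_pauli_mulVec, sum_sumElim]
  refine Finset.sum_congr rfl fun j _ => Finset.sum_congr rfl fun m _ => ?_
  have h1 : Sum.elim j m + (onReceiver ι v).1 = Sum.elim j (m + v.1) := by
    ext i
    cases i <;> simp [onReceiver]
  have h2 : (onReceiver ι v).2 ⬝ᵥ Sum.elim j m = v.2 ⬝ᵥ m := by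
    simp [onReceiver, dotProduct]
  rw [h1, h2]

/-- If all nontrivial errors on the receiver's qudits annihilate the code, then the receiver's
qudits are maximally mixed and uncorrelated with the encoded state. -/
theorem sum_star_mul_of_annihilates {Q : Submodule ℂ ((ι ⊕ κ → F) → ℂ)}
    (hQ : ∀ v : (κ → F) × (κ → F), v ≠ 0 → Annihilates p Q (onReceiver ι v))
    {x y : (ι ⊕ κ → F) → ℂ} (hx : x ∈ Q) (hy : y ∈ Q) (m m' : κ → F) :
    (Fintype.card F : ℂ) ^ Fintype.card κ *
      ∑ j : ι → F, star (x (Sum.elim j m)) * y (Sum.elim j m') =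
      if m = m' then star x ⬝ᵥ y else 0 := by
  -- Fourier inversion over the `Z(b)` part isolates the receiver state `m'`, and the shift by `m -
  -- m'` pairs it with `m`.
  have h1 : ∑ b : κ → F, chr p (b ⬝ᵥ (-m')) *
      (star x ⬝ᵥ (pauli p (onReceiver ι (m - m', b)) *ᵥ y)) =
      (Fintype.card F : ℂ) ^ Fintype.card κ *
      ∑ j : ι → F, star (x (Sum.elim j m)) * y (Sum.elim j m') := by
    simp only [dotProduct_onReceiver, Finset.mul_sum]
    rw [Finset.sum_comm]
    refine Finset.sum_congr rfl fun j _ => ?_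
    rw [Finset.sum_comm, Finset.sum_eq_single m']
    · have e : m' + (m - m') = m := by abel
      have e2 : ∀ b : κ → F, chr p (b ⬝ᵥ (-m')) * (star (x (Sum.elim j (m' + (m - m')))) *
          (chr p (b ⬝ᵥ m') * y (Sum.elim j m'))) =
          star (x (Sum.elim j m)) * y (Sum.elim j m') := by
        intro b
        rw [dotProduct_neg, AddChar.map_neg_eq_inv, e]
        have := chr_ne_zero p (b ⬝ᵥ m')
        field_simp
      rw [Finset.sum_congr rfl fun b _ => e2 b]
      simp
    · intro n _ hn
      have e2 : ∀ b : κ → F, chr p (b ⬝ᵥ (-m')) * (star (x (Sum.elim j (n + (m - m')))) *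
          (chr p (b ⬝ᵥ n) * y (Sum.elim j n))) =
          chr p (b ⬝ᵥ (n - m')) *
            (star (x (Sum.elim j (n + (m - m')))) * y (Sum.elim j n)) := by
        intro b
        rw [sub_eq_add_neg n, dotProduct_add, AddChar.map_add_eq_mul]
        ring
      rw [Finset.sum_congr rfl fun b _ => e2 b, ← Finset.sum_mul, sum_chr_dotProduct,
        if_neg (sub_ne_zero.2 hn), zero_mul]
    · simp
  rw [← h1]
  split_ifs with h
  · subst h
    rw [Finset.sum_eq_single 0]
    · have : onReceiver ι ((m - m, 0) : (κ → F) × (κ → F)) = 0 := by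
        rw [sub_self]
        ext i <;> cases i <;> rfl
      rw [this, pauli_zero]
      simp
    · intro b _ hb
      rw [hQ _ (by simp [hb]) x hx y hy, mul_zero]
    · simp
  · refine Finset.sum_eq_zero fun b _ => ?_
    rw [hQ _ (by simp [sub_eq_zero, h]) x hx y hy, mul_zero]

theorem exists_isometry {α γ : Type*} [Fintype α] [Fintype γ] (Q : Submodule ℂ (γ → ℂ))
    (hQ : Module.finrank ℂ Q = Fintype.card α) :
    ∃ V : (α → ℂ) →ₗ[ℂ] (γ → ℂ), (∀ x y, star (V x) ⬝ᵥ V y = star x ⬝ᵥ y) ∧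
      LinearMap.range V = Q := by
  let e := (WithLp.linearEquiv 2 ℂ (γ → ℂ)).symm
  let Q' : Submodule ℂ (EuclideanSpace ℂ γ) := Q.map (e : (γ → ℂ) →ₗ[ℂ] EuclideanSpace ℂ γ)
  have hQ' : Module.finrank ℂ Q' = Fintype.card α := by
    rw [← hQ]
    exact LinearEquiv.finrank_map_eq e Q
  let b := (stdOrthonormalBasis ℂ Q').reindex (Fintype.equivOfCardEq (by simp [hQ']) : _ ≃ α)
  let V₀ : EuclideanSpace ℂ α →ₗᵢ[ℂ] EuclideanSpace ℂ γ :=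
    Q'.subtypeₗᵢ.comp b.repr.symm.toLinearIsometry
  let V : (α → ℂ) →ₗ[ℂ] (γ → ℂ) :=
    e.symm.toLinearMap ∘ₗ V₀.toLinearMap ∘ₗ (WithLp.linearEquiv 2 ℂ (α → ℂ)).symm.toLinearMap
  refine ⟨V, fun x y => ?_, ?_⟩
  · have h := V₀.inner_map_map (WithLp.toLp 2 x) (WithLp.toLp 2 y)
    rw [EuclideanSpace.inner_eq_star_dotProduct, EuclideanSpace.inner_eq_star_dotProduct,
      dotProduct_comm, dotProduct_comm _ (star _)] at h
    exact h
  · ext x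
    constructor
    · rintro ⟨y, rfl⟩
      obtain ⟨w, hw, hwe⟩ := (b.repr.symm (WithLp.toLp 2 y)).2
      have : V y = w := by
        change e.symm (b.repr.symm (WithLp.toLp 2 y)) = w
        rw [← hwe]
        exact e.symm_apply_apply w
      rw [this]
      exact hw
    · intro hx
      refine ⟨WithLp.ofLp (b.repr ⟨e x, x, hx, rfl⟩), ?_⟩
      change e.symm (b.repr.symm (b.repr ⟨e x, x, hx, rfl⟩) : Q') = x
      rw [b.repr.symm_apply_apply]
      exact e.symm_apply_apply x

/-- Take an isometry `V` onto `Q` and let `W` send `ψ ⊗ |m⟩` to the rescaled slice of `V ψ` at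
receiver state `m`. Slices at different `m` are orthogonal and those at equal `m` reproduce the
inner product up to a factor, so `W` is an isometry. -/
theorem isEntanglementEncoded_of_annihilates {Q : Submodule ℂ ((ι ⊕ κ → F) → ℂ)} {k : ℕ}
    (hdim : Module.finrank ℂ Q = Fintype.card F ^ k)
    (hQ : ∀ v : (κ → F) × (κ → F), v ≠ 0 → Annihilates p Q (onReceiver ι v)) :
    IsEntanglementEncoded Q k := by
  obtain ⟨V, hV, hVQ⟩ := exists_isometry (α := Fin k → F) Q (by simp [hdim])
  have hVmem : ∀ x, V x ∈ Q := fun x => hVQ ▸ LinearMap.mem_range_self V x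
  -- Each slice carries the fraction `q ^ (-|κ|)` of the squared norm; `r` compensates for it.
  let r : ℝ := Real.sqrt ((Fintype.card F : ℝ) ^ Fintype.card κ)
  have hr : (r : ℂ) * r = (Fintype.card F : ℂ) ^ Fintype.card κ := by
    rw [← Complex.ofReal_mul, Real.mul_self_sqrt (by positivity)]
    simp
  have hr0 : (r : ℂ) ≠ 0 := by
    intro h
    rw [h, mul_zero] at hr
    exact pow_ne_zero _ (Nat.cast_ne_zero.2 Fintype.card_ne_zero) hr.symm
  let W : (((Fin k → F) × (κ → F)) → ℂ) →ₗ[ℂ] ((ι → F) → ℂ) :=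
    (r : ℂ) • ∑ m : κ → F, LinearMap.funLeft ℂ ℂ (fun j : ι → F => Sum.elim j m) ∘ₗ V ∘ₗ
      LinearMap.funLeft ℂ ℂ (fun s : Fin k → F => (s, m))
  have hW : ∀ x j, W x j = r * ∑ m : κ → F, V (fun s => x (s, m)) (Sum.elim j m) := by
    intro x j
    simp only [W, LinearMap.smul_apply, LinearMap.sum_apply, Pi.smul_apply, Finset.sum_apply,
      smul_eq_mul]
    rfl
  refine ⟨W, fun x y => ?_, fun Ψ => ?_⟩
  · have h1 : star (W x) ⬝ᵥ W y = ∑ m : κ → F, ∑ m' : κ → F,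
        (Fintype.card F : ℂ) ^ Fintype.card κ * ∑ j : ι → F,
          star (V (fun s => x (s, m)) (Sum.elim j m)) *
            V (fun s => y (s, m')) (Sum.elim j m') := by
      simp only [dotProduct, Pi.star_apply, hW, star_mul', star_sum, Finset.mul_sum,
        Finset.sum_mul]
      rw [Finset.sum_comm]
      conv_lhs => enter [2, m']; rw [Finset.sum_comm]
      rw [Finset.sum_comm]
      refine Finset.sum_congr rfl fun m _ => Finset.sum_congr rfl fun m' _ =>
        Finset.sum_congr rfl fun j _ => ?_
      rw [← hr, Complex.star_def, Complex.conj_ofReal]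
      ring
    rw [h1]
    simp only [sum_star_mul_of_annihilates hQ (hVmem _) (hVmem _), Finset.sum_ite_eq,
      Finset.mem_univ, if_true, hV]
    simp only [dotProduct, Fintype.sum_prod_type, Pi.star_apply]
    rw [Finset.sum_comm]
  · have hWδ : ∀ (ψ : (Fin k → F) → ℂ) (j : ι → F) (m : κ → F),
        W (fun s => if s.2 = m then ψ s.1 else 0) j = r * V ψ (Sum.elim j m) := by
      intro ψ j m
      rw [hW, Finset.sum_eq_single m]
      · simp
      · intro n _ hn
        have : (fun s : Fin k → F => if (s, n).2 = m then ψ (s, n).1 else 0) = 0 := by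
          ext s
          simp [hn]
        rw [this, map_zero]
        rfl
      · simp
    simp only [hWδ]
    constructor
    · intro hΨ
      rw [← hVQ] at hΨ
      obtain ⟨ψ, rfl⟩ := hΨ
      refine ⟨(r : ℂ)⁻¹ • ψ, fun j m => ?_⟩
      rw [map_smul, Pi.smul_apply, smul_eq_mul, mul_inv_cancel_left₀ hr0]
    · rintro ⟨ψ, hψ⟩
      have : Ψ = (r : ℂ) • V ψ := by
        ext i
        rw [← Sum.elim_comp_inl_inr i, hψ]
        rfl
      rw [this]
      exact Q.smul_mem _ (hVmem ψ)

end Encoding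

/-! ### The symplectic and Hermitian forms compared through `phi`. -/

section Labels

variable {F K : Type*} [Field F] [Fintype F] [Field K] [Algebra F K]
variable {ι κ : Type*} [Fintype ι] [Fintype κ]

variable (F) in
theorem add_pow_card (x y : K) :
    (x + y) ^ Fintype.card F = x ^ Fintype.card F + y ^ Fintype.card F :=
  map_add (FiniteField.frobeniusAlgHom F K) x y

variable (F) in
theorem sum_pow_card (x : ι → K) :
    (∑ i, x i) ^ Fintype.card F = ∑ i, x i ^ Fintype.card F :=
  map_sum (FiniteField.frobeniusAlgHom F K) x Finset.univ

theorem algebraMap_pow_card (r : F) :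
    algebraMap F K r ^ Fintype.card F = algebraMap F K r :=
  (FiniteField.frobeniusAlgHom F K).commutes r

theorem card_of_finrank_eq_two (hK : Module.finrank F K = 2) :
    Nat.card K = Fintype.card F ^ 2 := by
  have : Module.Finite F K := Module.finite_of_finrank_pos (by omega)
  rw [Module.natCard_eq_pow_finrank (K := F), hK, Nat.card_eq_fintype_card]

theorem pow_card_pow_card (hK : Module.finrank F K = 2) (x : K) :
    (x ^ Fintype.card F) ^ Fintype.card F = x := by
  have : Module.Finite F K := Module.finite_of_finrank_pos (by omega)
  have : Finite K := Module.finite_of_finite F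
  have := Fintype.ofFinite K
  have h := card_of_finrank_eq_two hK
  rw [Nat.card_eq_fintype_card] at h
  rw [← pow_mul, ← sq, ← h, FiniteField.pow_card]

variable (F) in
theorem hermInner_smul_right (x y : ι → K) (r : K) :
    hermInner F x (r • y) = r ^ Fintype.card F * hermInner F x y := by
  simp only [hermInner, Pi.smul_apply, smul_eq_mul, mul_pow, Finset.mul_sum]
  exact Finset.sum_congr rfl fun i _ => by ring

theorem hermInner_pow (hK : Module.finrank F K = 2) (x y : ι → K) :
    hermInner F x y ^ Fintype.card F = hermInner F y x := by
  rw [hermInner, sum_pow_card F]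
  simp only [mul_pow, pow_card_pow_card hK]
  exact Finset.sum_congr rfl fun i _ => mul_comm _ _

/-- `phi` as an `F`-linear map. -/
def phiHom (β : K) : ((ι → F) × (ι → F)) →ₗ[F] (ι → K) where
  toFun := phi F β
  map_add' v w := by
    ext i
    simp only [phi, Prod.fst_add, Prod.snd_add, Pi.add_apply, map_add]
    ring
  map_smul' r v := by
    ext i
    simp only [phi, Prod.smul_fst, Prod.smul_snd, Pi.smul_apply, smul_eq_mul, map_mul,
      RingHom.id_apply, Algebra.smul_def r (_ : K)]
    ring

variable {β : K} (hβ : LinearIndependent F ![β, β ^ Fintype.card F])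
include hβ

theorem phi_apply_eq_zero_iff (v : (ι → F) × (ι → F)) (i : ι) :
    phi F β v i = 0 ↔ v.1 i = 0 ∧ v.2 i = 0 := by
  constructor
  · intro h
    refine LinearIndependent.pair_iff.1 hβ _ _ ?_
    rw [Algebra.smul_def, Algebra.smul_def, mul_comm, mul_comm (algebraMap F K _)]
    exact h
  · rintro ⟨h1, h2⟩
    simp [phi, h1, h2]

theorem phi_eq_zero_iff (v : (ι → F) × (ι → F)) : phi F β v = 0 ↔ v = 0 := by
  simp only [funext_iff, Prod.ext_iff, Pi.zero_apply, phi_apply_eq_zero_iff hβ, forall_and,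
    Prod.fst_zero, Prod.snd_zero]

theorem phi_injective : Function.Injective (phi F β : (ι → F) × (ι → F) → ι → K) := by
  intro v w h
  rw [← sub_eq_zero, ← phi_eq_zero_iff hβ]
  exact (map_sub (phiHom β) v w).trans (sub_eq_zero.2 h)

theorem phi_bijective (hK : Module.finrank F K = 2) :
    Function.Bijective (phi F β : (ι → F) × (ι → F) → ι → K) := by
  have : Module.Finite F K := Module.finite_of_finrank_pos (by omega)
  refine ⟨phi_injective hβ, ?_⟩
  refine (LinearMap.injective_iff_surjective_of_finrank_eq_finrank (f := phiHom (F := F) β) ?_).1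
    (phi_injective hβ)
  rw [Module.finrank_prod, Module.finrank_pi, Module.finrank_pi_fintype]
  simp [hK]
  ring

theorem hammingNorm_phi [DecidableEq F] [DecidableEq K] (v : (ι → F) × (ι → F)) :
    hammingNorm (phi F β v) = swt v := by
  simp only [hammingNorm, swt, ne_eq, phi_apply_eq_zero_iff hβ, not_and_or]

theorem sub_pow_card_ne_zero : β - β ^ Fintype.card F ≠ 0 := by
  intro h
  have := LinearIndependent.pair_iff.1 hβ 1 (-1) (by simpa [sub_eq_add_neg] using h)
  exact one_ne_zero this.1

theorem add_pow_card_ne_zero : β + β ^ Fintype.card F ≠ 0 := by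
  intro h
  have := LinearIndependent.pair_iff.1 hβ 1 1 (by simpa using h)
  exact one_ne_zero this.1

omit hβ in
-- The symmetric terms cancel. The constant `β² - β^(2q)` is nonzero when `β` and `β^q` are
-- independent, since then `β ≠ ±β^q`.
theorem hermInner_phi_sub (hK : Module.finrank F K = 2) (v w : (ι → F) × (ι → F)) :
    hermInner F (phi F β v) (phi F β w) - hermInner F (phi F β w) (phi F β v) =
      (β + β ^ Fintype.card F) * (β - β ^ Fintype.card F) *
        algebraMap F K (w.2 ⬝ᵥ v.1 - v.2 ⬝ᵥ w.1) := by
  simp only [hermInner, dotProduct, map_sub, map_sum, ← Finset.sum_sub_distrib, Finset.mul_sum]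
  refine Finset.sum_congr rfl fun i _ => ?_
  simp only [phi, add_pow_card F, mul_pow, pow_card_pow_card hK, algebraMap_pow_card, map_mul]
  ring

/-- The labels of the Pauli operators that correspond to the words of a code. -/
def codeLabels (F : Type*) {K : Type*} [Field F] [Fintype F] [Field K] [Algebra F K]
    {ι : Type*} [Fintype ι] (β : K) (C : Submodule K (ι → K)) :
    AddSubgroup ((ι → F) × (ι → F)) :=
  C.toAddSubgroup.comap (phiHom (F := F) β).toAddMonoidHom

omit hβ in
theorem mem_codeLabels {C : Submodule K (ι → K)} {v : (ι → F) × (ι → F)} :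
    v ∈ codeLabels F β C ↔ phi F β v ∈ C := Iff.rfl

theorem ncard_codeLabels (hK : Module.finrank F K = 2) (C : Submodule K (ι → K)) :
    (codeLabels F β C : Set ((ι → F) × (ι → F))).ncard =
      Fintype.card F ^ (2 * Module.finrank K C) := by
  have h1 : (phi F β '' (codeLabels F β C : Set ((ι → F) × (ι → F)))) = C :=
    Set.image_preimage_eq (C : Set (ι → K)) (phi_bijective hβ hK).2
  rw [← Set.ncard_image_of_injective _ (phi_injective hβ), h1, ← Nat.card_coe_set_eq]
  change Nat.card C = _
  rw [Module.natCard_eq_pow_finrank (K := K), card_of_finrank_eq_two hK, pow_mul]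

/-- The labels commuting with all labels of `C` are those of the Hermitian dual of `C`. -/
theorem phi_mem_hermDual_iff [DecidableEq F] (p : ℕ) [Fact p.Prime] [Algebra (ZMod p) F]
    (hK : Module.finrank F K = 2) (C : Submodule K (ι → K)) (v : (ι → F) × (ι → F)) :
    phi F β v ∈ hermDual F C ↔ ∀ w ∈ codeLabels F β C, Commutes p v w := by
  have hne : (β + β ^ Fintype.card F) * (β - β ^ Fintype.card F) ≠ 0 :=
    mul_ne_zero (add_pow_card_ne_zero hβ) (sub_pow_card_ne_zero hβ)
  constructor
  · intro hv w hw
    have h1 : hermInner F (phi F β v) (phi F β w) = 0 := hv _ hw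
    have h2 := hermInner_phi_sub (β := β) hK v w
    rw [← hermInner_pow hK (phi F β v), h1, zero_pow Fintype.card_ne_zero, sub_zero] at h2
    have h3 := (mul_eq_zero.1 h2.symm).resolve_left hne
    rw [map_eq_zero, sub_eq_zero] at h3
    rw [Commutes, h3]
  · intro hv
    have key : ∀ y ∈ C, hermInner F (phi F β v) y = hermInner F (phi F β v) y ^ Fintype.card F := by
      intro y hy
      obtain ⟨w, rfl⟩ := (phi_bijective (ι := ι) hβ hK).2 y
      -- Commuting with `w` only says that a trace vanishes; commuting with all `F`-multiples of `w`
      -- makes the symplectic product itself vanish.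
      have h0 : w.2 ⬝ᵥ v.1 - v.2 ⬝ᵥ w.1 = 0 := by
        by_contra hx
        obtain ⟨r, hr⟩ := exists_chr_mul_ne_one p hx
        apply hr
        have hrw : r • w ∈ codeLabels F β C := by
          have : phi F β (r • w) = algebraMap F K r • phi F β w := by
            rw [algebraMap_smul]
            exact map_smul (phiHom β) r w
          rw [mem_codeLabels, this]
          exact C.smul_mem _ hy
        have h1 := hv _ hrw
        simp only [Commutes, Prod.smul_fst, Prod.smul_snd, dotProduct_smul, smul_dotProduct,
          smul_eq_mul] at h1
        rw [mul_sub, sub_eq_add_neg, AddChar.map_add_eq_mul, AddChar.map_neg_eq_inv, ← h1,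
          mul_inv_cancel₀ (chr_ne_zero p _)]
      have h2 := hermInner_phi_sub (β := β) hK v w
      rw [h0, map_zero, mul_zero, sub_eq_zero] at h2
      rw [hermInner_pow hK, h2]
    intro y hy
    have h1 := key y hy
    -- The product `h` with `y` is fixed by conjugation, and so is the product `β^q h` with `β y`;
    -- this forces `β h = β^q h`, hence `h = 0`. Here linearity over `K` is essential.
    have h2 := key _ (C.smul_mem β hy)
    rw [hermInner_smul_right, mul_pow, pow_card_pow_card hK, ← h1] at h2
    have h3 : (β - β ^ Fintype.card F) * hermInner F (phi F β v) y = 0 := by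
      rw [sub_mul, h2, sub_self]
    exact (mul_eq_zero.1 h3).resolve_left (sub_pow_card_ne_zero hβ)

theorem commutes_of_le_hermDual [DecidableEq F] (p : ℕ) [Fact p.Prime] [Algebra (ZMod p) F]
    (hK : Module.finrank F K = 2) {C : Submodule K (ι → K)} (hC : C ≤ hermDual F C) :
    ∀ v ∈ codeLabels F β C, ∀ w ∈ codeLabels F β C, Commutes p v w := fun v hv =>
  (phi_mem_hermDual_iff hβ p hK C v).1 (hC hv)

theorem image_codeLabels (hK : Module.finrank F K = 2) (C : Submodule K (ι → K)) (f : κ → ι) :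
    (fun v : (ι → F) × (ι → F) => ((v.1 ∘ f, v.2 ∘ f) : (κ → F) × (κ → F))) ''
      (codeLabels F β C : Set ((ι → F) × (ι → F))) =
      (codeLabels F β (C.map (LinearMap.funLeft K K f)) : Set ((κ → F) × (κ → F))) := by
  ext w
  constructor
  · rintro ⟨v, hv, rfl⟩
    exact ⟨phi F β v, hv, rfl⟩
  · rintro ⟨x, hx, hxw⟩
    obtain ⟨v, rfl⟩ := (phi_bijective (ι := ι) hβ hK).2 x
    exact ⟨v, hx, phi_injective hβ hxw⟩

end Labels

/-! ### Coordinate permutations and information sets of linear codes. -/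

section Classical

variable {F K : Type*} [Field F] [Fintype F] [Field K] [Algebra F K]
variable {ι κ : Type*} [Fintype ι] [Fintype κ]

theorem hermInner_comp_equiv (x y : ι → K) (e : κ ≃ ι) :
    hermInner F (x ∘ e) (y ∘ e) = hermInner F x y :=
  Fintype.sum_equiv e _ _ fun _ => rfl

theorem comp_equiv_mem_map_iff (C : Submodule K (ι → K)) (e : κ ≃ ι) (x : ι → K) :
    x ∘ e ∈ C.map (LinearMap.funLeft K K e) ↔ x ∈ C := by
  constructor
  · rintro ⟨y, hy, hyx⟩
    have : y = x := e.surjective.injective_comp_right hyx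
    rwa [← this]
  · exact fun hx => ⟨x, hx, rfl⟩

theorem comp_equiv_mem_hermDual_iff (C : Submodule K (ι → K)) (e : κ ≃ ι) (x : ι → K) :
    x ∘ e ∈ hermDual F (C.map (LinearMap.funLeft K K e)) ↔ x ∈ hermDual F C := by
  constructor
  · intro h y hy
    rw [← hermInner_comp_equiv x y e]
    exact h _ ⟨y, hy, rfl⟩
  · rintro h _ ⟨y, hy, rfl⟩
    exact (hermInner_comp_equiv x y e).trans (h y hy)

theorem hammingNorm_comp_equiv [DecidableEq K] (x : ι → K) (e : κ ≃ ι) :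
    hammingNorm (x ∘ e) = hammingNorm x := by
  classical
  rw [hammingNorm, hammingNorm]
  refine Finset.card_equiv e fun i => ?_
  simp

theorem exists_comp_equiv_eq (e : κ ≃ ι) (x : κ → K) : ∃ y : ι → K, y ∘ e = x :=
  ⟨x ∘ e.symm, by ext i; simp⟩

theorem map_equiv_le_hermDual {C : Submodule K (ι → K)} (hC : C ≤ hermDual F C) (e : κ ≃ ι) :
    C.map (LinearMap.funLeft K K e) ≤ hermDual F (C.map (LinearMap.funLeft K K e)) := by
  rintro _ ⟨x, hx, rfl⟩
  exact (comp_equiv_mem_hermDual_iff C e x).2 (hC hx)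

theorem isDualDistance_map_equiv [DecidableEq K] {C : Submodule K (ι → K)} {d : ℕ}
    (hd : IsDualDistance F C d) (e : κ ≃ ι) :
    IsDualDistance F (C.map (LinearMap.funLeft K K e)) d := by
  have h : {w : ℕ | ∃ x ∈ hermDual F (C.map (LinearMap.funLeft K K e)),
      x ≠ 0 ∧ hammingNorm x = w} = {w : ℕ | ∃ x ∈ hermDual F C, x ≠ 0 ∧ hammingNorm x = w} := by
    ext w
    constructor
    · rintro ⟨x, hx, hx0, hxw⟩
      obtain ⟨y, rfl⟩ := exists_comp_equiv_eq e x
      rw [comp_equiv_mem_hermDual_iff] at hx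
      rw [hammingNorm_comp_equiv] at hxw
      exact ⟨y, hx, by rintro rfl; exact hx0 rfl, hxw⟩
    · rintro ⟨x, hx, hx0, hxw⟩
      refine ⟨x ∘ e, (comp_equiv_mem_hermDual_iff C e x).2 hx, ?_, ?_⟩
      · intro h
        exact hx0 (e.surjective.injective_comp_right h)
      · rwa [hammingNorm_comp_equiv]
  unfold IsDualDistance
  rw [h]
  exact hd

/-- `T` is contained in an information set of `C`. -/
def IsIndependentOn (C : Submodule K (ι → K)) (T : Finset ι) : Prop :=
  ∀ a : ι → K, (∀ i ∉ T, a i = 0) → (∀ y ∈ C, ∑ i, a i * y i = 0) → a = 0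

/-- A maximal set of independent coordinate functionals from `A` still separates the words of `C`,
so it has at least `finrank K C` elements; any `c` of them serve. -/
theorem exists_isIndependentOn [DecidableEq ι] {C : Submodule K (ι → K)} {A : Set ι}
    (hA : ∀ y ∈ C, (∀ i ∈ A, y i = 0) → y = 0) {c : ℕ} (hc : c ≤ Module.finrank K C) :
    ∃ T : Finset ι, (T : Set ι) ⊆ A ∧ T.card = c ∧ IsIndependentOn C T := by
  classical
  let f : ι → Module.Dual K C := fun i => LinearMap.proj i ∘ₗ C.subtype
  obtain ⟨b, hbA, -, hspan, hb⟩ := exists_linearIndepOn_extension (v := f)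
    (linearIndepOn_empty K f) (Set.empty_subset A)
  have hinj : Function.Injective (LinearMap.funLeft K K ((↑) : b → ι) ∘ₗ C.subtype) := by
    rw [injective_iff_map_eq_zero]
    rintro ⟨y, hy⟩ h
    refine Subtype.ext (hA y hy fun i hi => ?_)
    have hle : Submodule.span K (f '' b) ≤
        LinearMap.ker (Module.Dual.eval K C ⟨y, hy⟩) := by
      rw [Submodule.span_le]
      rintro _ ⟨j, hj, rfl⟩
      exact congrFun h ⟨j, hj⟩
    exact hle (hspan ⟨i, hi, rfl⟩)
  have hcard := LinearMap.finrank_le_finrank_of_injective hinj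
  rw [Module.finrank_pi, ← Set.toFinset_card] at hcard
  obtain ⟨T, hTb, hTc⟩ := Finset.exists_subset_card_eq (hc.trans hcard)
  have hTb' : (T : Set ι) ⊆ b := fun i hi => Set.mem_toFinset.1 (hTb hi)
  refine ⟨T, hTb'.trans hbA, hTc, fun a ha hy => ?_⟩
  have hT : LinearIndepOn K f (T : Set ι) := hb.mono hTb'
  have h0 := (linearIndepOn_finset_iff.1 hT) a ?_
  · ext i
    by_cases hi : i ∈ T
    · exact h0 i hi
    · exact ha i hi
  · ext y
    rw [LinearMap.sum_apply, LinearMap.zero_apply, ← hy y y.2]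
    refine Finset.sum_subset (Finset.subset_univ T) fun i _ hi => ?_
    rw [ha i hi]
    simp

variable {C : Submodule K (ι → K)} {T : Finset ι}

/-- The conjugated entries of a dual word supported on `T` are the coefficients of a linear relation
among the coordinate functionals of `T`. -/
theorem IsIndependentOn.eq_zero_of_mem_hermDual (hK : Module.finrank F K = 2)
    (hT : IsIndependentOn C T) {x : ι → K} (hx : x ∈ hermDual F C) (hxT : ∀ i ∉ T, x i = 0) :
    x = 0 := by
  have h := hT (fun i => x i ^ Fintype.card F)
    (fun i hi => by rw [hxT i hi, zero_pow Fintype.card_ne_zero]) fun y hy => ?_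
  · ext i
    exact eq_zero_of_pow_eq_zero (congrFun h i)
  · have h1 := hermInner_pow hK x y
    rw [hx y hy, zero_pow Fintype.card_ne_zero] at h1
    rw [h1, hermInner]
    exact Finset.sum_congr rfl fun i _ => mul_comm _ _

/-- The words of `C` that vanish on `T`. -/
def vanishingOn (C : Submodule K (ι → K)) (T : Finset ι) : Submodule K (ι → K) :=
  C ⊓ LinearMap.ker (LinearMap.funLeft K K ((↑) : T → ι))

theorem mem_vanishingOn {x : ι → K} :
    x ∈ vanishingOn C T ↔ x ∈ C ∧ ∀ i ∈ T, x i = 0 := by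
  refine and_congr Iff.rfl ?_
  rw [SetLike.mem_coe, LinearMap.mem_ker, funext_iff]
  exact ⟨fun h i hi => h ⟨i, hi⟩, fun h i => h i i.2⟩

/-- Restriction of `C` to `T` is onto, because a functional killing its image would be a relation
among the coordinates in `T`; then apply rank-nullity. -/
theorem IsIndependentOn.finrank_vanishingOn [DecidableEq ι] (hT : IsIndependentOn C T) :
    Module.finrank K (vanishingOn C T) + T.card = Module.finrank K C := by
  let ρ : C →ₗ[K] (T → K) := LinearMap.funLeft K K ((↑) : T → ι) ∘ₗ C.subtype
  have hρ : LinearMap.range ρ = ⊤ := by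
    by_contra hne
    obtain ⟨f, hf, hle⟩ := Submodule.exists_le_ker_of_lt_top _ (lt_top_iff_ne_top.2 hne)
    apply hf
    have ha := hT (fun i => if h : i ∈ T then f (Pi.single ⟨i, h⟩ 1) else 0)
      (fun i hi => dif_neg hi) fun y hy => ?_
    · ext i
      have := congrFun ha i
      simpa using this
    · have h1 : f (ρ ⟨y, hy⟩) = 0 := hle ⟨_, rfl⟩
      rw [LinearMap.pi_apply_eq_sum_univ f] at h1
      rw [← Finset.sum_subset (Finset.subset_univ T), ← h1, ← Finset.sum_coe_sort]
      · refine Finset.sum_congr rfl fun i _ => ?_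
        rw [dif_pos i.2, mul_comm, smul_eq_mul]
        congr 2
        ext j
        simp [Pi.single_apply, eq_comm]
      · intro i _ hi
        rw [dif_neg hi, zero_mul]
  have h1 := LinearMap.finrank_range_add_finrank_ker ρ
  rw [hρ, finrank_top, Module.finrank_pi, Fintype.card_coe] at h1
  have h2 : Module.finrank K (LinearMap.ker ρ) = Module.finrank K (vanishingOn C T) := by
    rw [vanishingOn, ← Submodule.map_comap_subtype, Submodule.finrank_map_subtype_eq]
    rfl
  omega

end Classical

/-! ### Dimension and Hermitian radical of the punctured code. -/

section Puncturing

variable {F K : Type*} [Field F] [Fintype F] [Field K] [Algebra F K]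
variable {ι : Type*} [Fintype ι] [DecidableEq ι] {C : Submodule K (ι → K)} {T : Finset ι}

/-- The code obtained by deleting the coordinates in `T`. -/
def puncture (C : Submodule K (ι → K)) (T : Finset ι) : Submodule K ({i // i ∉ T} → K) :=
  C.map (LinearMap.funLeft K K (Subtype.val : {i // i ∉ T} → ι))

theorem finrank_puncture_of_eq_zero {D : Submodule K (ι → K)}
    (h : ∀ x ∈ D, (∀ i ∉ T, x i = 0) → x = 0) :
    Module.finrank K (puncture D T) = Module.finrank K D := by
  have hinj : Function.Injective
      (LinearMap.funLeft K K (Subtype.val : {i // i ∉ T} → ι) ∘ₗ D.subtype) := by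
    rw [injective_iff_map_eq_zero]
    rintro ⟨y, hy⟩ h0
    exact Subtype.ext (h y hy fun i hi => congrFun h0 ⟨i, hi⟩)
  rw [← LinearMap.finrank_range_of_inj hinj, LinearMap.range_comp, Submodule.range_subtype,
    puncture]

theorem sum_eq_sum_compl {M : Type*} [AddCommMonoid M] (f : ι → M) (hf : ∀ i ∈ T, f i = 0) :
    ∑ i, f i = ∑ i : {i // i ∉ T}, f i := by
  rw [← Finset.sum_subset (Finset.subset_univ (Finset.univ.filter (· ∉ T)))]
  · exact (Finset.sum_subtype _ (by simp) f)
  · intro i _ hi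
    exact hf i (by simpa using hi)

theorem sum_eq_of_compl_eq {M : Type*} [AddCommMonoid M] (f g : ι → M) (hfg : ∀ i ∉ T, f i = g i)
    (hg : ∀ i ∈ T, g i = 0) : ∑ i : {i // i ∉ T}, f i = ∑ i, g i := by
  rw [sum_eq_sum_compl g hg]
  exact Finset.sum_congr rfl fun i _ => hfg i i.2

variable (hK : Module.finrank F K = 2) (hC : C ≤ hermDual F C) (hT : IsIndependentOn C T)
include hK hC hT

theorem finrank_puncture : Module.finrank K (puncture C T) = Module.finrank K C :=
  finrank_puncture_of_eq_zero fun _ hx hxT => hT.eq_zero_of_mem_hermDual hK (hC hx) hxT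

/-- If the punctured `x` is orthogonal to the punctured code, then `x` with its entries on `T` set
to zero lies in the dual. Its difference from `x` is a dual word supported on `T`, hence zero. -/
theorem puncture_inf_hermDual :
    puncture C T ⊓ hermDual F (puncture C T) = puncture (vanishingOn C T) T := by
  ext x'
  constructor
  · rintro ⟨⟨x, hx, rfl⟩, hxd⟩
    refine ⟨x, mem_vanishingOn.2 ⟨hx, ?_⟩, rfl⟩
    have h0 : x - (fun i => if i ∈ T then 0 else x i) = 0 := by
      refine hT.eq_zero_of_mem_hermDual hK (F := F) (Submodule.sub_mem _ (hC hx) ?_) ?_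
      · intro y hy
        refine Eq.trans ?_ (hxd _ ⟨y, hy, rfl⟩)
        refine (sum_eq_of_compl_eq (fun i => x i * y i ^ Fintype.card F) _ ?_ ?_).symm
        · intro i hi
          simp [hi]
        · intro i hi
          simp [hi]
      · intro i hi
        simp [hi]
    intro i hi
    have := congrFun h0 i
    simpa [hi] using this
  · rintro ⟨x, hx, rfl⟩
    obtain ⟨hx, hxT⟩ := mem_vanishingOn.1 hx
    refine ⟨⟨x, hx, rfl⟩, ?_⟩
    rintro _ ⟨y, hy, rfl⟩
    rw [← hC hx y hy]
    exact (sum_eq_sum_compl (fun i => x i * y i ^ Fintype.card F)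
      fun i hi => by rw [hxT i hi, zero_mul]).symm

theorem finrank_puncture_inf_hermDual :
    Module.finrank K ↥(puncture C T ⊓ hermDual F (puncture C T)) + T.card =
      Module.finrank K C := by
  rw [puncture_inf_hermDual hK hC hT, finrank_puncture_of_eq_zero, hT.finrank_vanishingOn]
  intro x hx hxT
  ext i
  by_cases hi : i ∈ T
  · exact (mem_vanishingOn.1 hx).2 i hi
  · exact hxT i hi

end Puncturing

/-! ### Quantum parameters from the classical code. -/

section StabilizerCodes

variable {F K : Type*} [Field F] [Fintype F] [DecidableEq F] [Field K] [Algebra F K]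
variable {p : ℕ} [Fact p.Prime] [Algebra (ZMod p) F]
variable {ι : Type*} [Fintype ι] [DecidableEq ι]
variable {C : Submodule K (ι → K)} {β : K} {S : Subgroup (Matrix (ι → F) (ι → F) ℂ)ˣ}

section Errors

variable (hK : Module.finrank F K = 2) (hβ : LinearIndependent F ![β, β ^ Fintype.card F])
  (hS : IsStabilizerGroup p S) (hSC : tau p S = codeLabels F β C)
include hK hβ hSC

theorem annihilates_of_notMem_hermDual {v : (ι → F) × (ι → F)}
    (hv : phi F β v ∉ hermDual F C) : Annihilates p (fixedSpace S) v := by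
  rw [phi_mem_hermDual_iff hβ p hK] at hv
  push Not at hv
  obtain ⟨w, hw, hvw⟩ := hv
  exact annihilates_of_not_commutes (hSC ▸ hw) hvw

theorem annihilates_of_swt_lt [DecidableEq K] {d : ℕ} (hd : IsDualDistance F C d)
    {v : (ι → F) × (ι → F)} (hv : v ≠ 0) (hvd : swt v < d) : Annihilates p (fixedSpace S) v := by
  refine annihilates_of_notMem_hermDual hK hβ hSC fun h => ?_
  rw [← hammingNorm_phi (K := K) hβ] at hvd
  exact hvd.not_ge (hd.2 ⟨_, h, mt (phi_eq_zero_iff hβ v).1 hv, rfl⟩)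

theorem detects_of_swt_lt [DecidableEq K] {d : ℕ} (hd : IsDualDistance F C d)
    {v : (ι → F) × (ι → F)} (hvd : swt v < d) : Detects p (fixedSpace S) v := by
  by_cases hv : v = 0
  · rw [hv]
    exact detects_zero _
  · exact (annihilates_of_swt_lt hK hβ hSC hd hv hvd).detects

include hS

theorem not_detects_of_mem_hermDual {v : (ι → F) × (ι → F)} (hv : phi F β v ∈ hermDual F C)
    (hvC : phi F β v ∉ C) : ¬ Detects p (fixedSpace S) v := by
  refine hS.not_detects ?_ ?_
  · rw [hSC]
    exact hvC
  · rw [hSC]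
    exact (phi_mem_hermDual_iff hβ p hK C v).1 hv

theorem finrank_mul_pow :
    Module.finrank ℂ (fixedSpace S) * Fintype.card F ^ (2 * Module.finrank K C) =
      Fintype.card F ^ Fintype.card ι := by
  rw [← ncard_codeLabels hβ hK, ← hSC, hS.finrank_mul]

theorem two_mul_finrank_le : 2 * Module.finrank K C ≤ Fintype.card ι := by
  have h := finrank_mul_pow hK hβ hS hSC
  rw [← Nat.pow_le_pow_iff_right (Fintype.one_lt_card (α := F)), ← h]
  exact Nat.le_mul_of_pos_left _ (Nat.pos_of_ne_zero hS.finrank_ne_zero)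

theorem finrank_fixedSpace :
    Module.finrank ℂ (fixedSpace S) =
      Fintype.card F ^ (Fintype.card ι - 2 * Module.finrank K C) := by
  have h := finrank_mul_pow hK hβ hS hSC
  rw [← Nat.sub_add_cancel (two_mul_finrank_le hK hβ hS hSC), pow_add] at h
  exact Nat.eq_of_mul_eq_mul_right (pow_pos Fintype.card_pos _) h

variable [DecidableEq K] {d : ℕ} (hd : IsDualDistance F C d)
include hd

theorem isQECC_fixedSpace :
    IsQECC p (fixedSpace S) (Fintype.card ι) (Fintype.card ι - 2 * Module.finrank K C) d where
  length := rfl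
  dim := finrank_fixedSpace hK hβ hS hSC
  dist := by
    refine le_iInf₂ fun v hv => ?_
    by_contra! h
    exact hv (detects_of_swt_lt hK hβ hSC hd (by exact_mod_cast h))
  dist_zero _ _ hv hvd := annihilates_of_swt_lt hK hβ hSC hd hv hvd

theorem isPureTo (hC : C ≤ hermDual F C) : IsPureTo p S d := by
  intro v hv hv0
  rw [hSC] at hv
  rw [← hammingNorm_phi (K := K) hβ]
  exact hd.2 ⟨_, hC hv, mt (phi_eq_zero_iff hβ v).1 hv0, rfl⟩

theorem qDist_fixedSpace (hx : ∃ x ∈ hermDual F C, x ∉ C ∧ hammingNorm x = d) :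
    qDist p (fixedSpace S) = d := by
  refine le_antisymm ?_ (isQECC_fixedSpace hK hβ hS hSC hd).dist
  obtain ⟨x, hx, hxC, hxd⟩ := hx
  obtain ⟨v, rfl⟩ := (phi_bijective (ι := ι) hβ hK).2 x
  rw [← hxd, hammingNorm_phi hβ]
  exact iInf₂_le v (not_detects_of_mem_hermDual hK hβ hS hSC hx hxC)

end Errors

/-- A set of `c` coordinates inside an information set of `C`, which avoids the support of a word
of minimum weight in the dual if that word is not in `C`. -/
theorem exists_isIndependentOn_avoiding [DecidableEq K] {d : ℕ}
    (hd : IsDualDistance F C d) (hC : C ≤ hermDual F C) {c : ℕ} (hc : c ≤ Module.finrank K C) :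
    ∃ T : Finset ι, T.card = c ∧ IsIndependentOn C T ∧
      ((∃ x ∈ hermDual F C, x ∉ C ∧ hammingNorm x = d) →
        ∃ x ∈ hermDual F C, x ∉ C ∧ hammingNorm x = d ∧ ∀ i ∈ T, x i = 0) := by
  by_cases hx : ∃ x ∈ hermDual F C, x ∉ C ∧ hammingNorm x = d
  · obtain ⟨x, hx, hxC, hxd⟩ := hx
    have hA : ∀ y ∈ C, (∀ i ∈ {i | x i = 0}, y i = 0) → y = 0 := by
      intro y hy hyx
      by_contra hy0
      obtain ⟨i, hi⟩ := Function.ne_iff.1 hy0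
      have hi : y i ≠ 0 := hi
      have hxi : x i ≠ 0 := fun h => hi (hyx i h)
      -- This dual word vanishes at `i` and wherever `x` does, so it is lighter than `x`; it is
      -- nonzero as `x ∉ C`, against the minimality of `d`.
      set z := x - (x i / y i) • y with hz
      have hz0 : z ≠ 0 := by
        intro h
        apply hxC
        rw [sub_eq_zero.1 h]
        exact C.smul_mem _ hy
      have hzd : z ∈ hermDual F C := Submodule.sub_mem _ hx (Submodule.smul_mem _ _ (hC hy))
      have hle := hd.2 ⟨z, hzd, hz0, rfl⟩
      rw [← hxd] at hle
      refine hle.not_gt (Finset.card_lt_card (Finset.ssubset_iff_of_subset ?_ |>.2 ⟨i, ?_, ?_⟩))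
      · intro j hj
        simp only [Finset.mem_filter, Finset.mem_univ, true_and] at hj ⊢
        intro hxj
        apply hj
        simp [hz, hxj, hyx j hxj]
      · simpa using hxi
      · simp [hz, hi]
    obtain ⟨T, hTA, hTc, hT⟩ := exists_isIndependentOn hA hc
    exact ⟨T, hTc, hT, fun _ => ⟨x, hx, hxC, hxd, fun i hi => hTA hi⟩⟩
  · obtain ⟨T, -, hTc, hT⟩ := exists_isIndependentOn (C := C) (A := Set.univ)
      (fun y _ h => funext fun i => h i trivial) hc
    exact ⟨T, hTc, hT, fun h => absurd h hx⟩

theorem swt_onSender {κ : Type*} [Fintype κ] [DecidableEq κ] (v : (ι → F) × (ι → F)) :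
    swt (onSender κ v) = swt v := by
  rw [swt, swt, Finset.card_filter, Finset.card_filter, Fintype.sum_sum_type]
  simp only [onSender, Sum.elim_inl, Sum.elim_inr, Pi.zero_apply, ne_eq, not_true_eq_false,
    or_self, if_false, Finset.sum_const_zero, add_zero]
  congr!

theorem onSender_ne_zero {κ : Type*} {v : (ι → F) × (ι → F)} (hv : v ≠ 0) :
    onSender κ v ≠ 0 := by
  intro h
  apply hv
  have h1 := congrArg Prod.fst h
  have h2 := congrArg Prod.snd h
  exact Prod.ext (funext fun i => congrFun h1 (Sum.inl i)) (funext fun i => congrFun h2 (Sum.inl i))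

/-- The coordinates outside `T`, followed by those in `T`. -/
def complSumEquiv (T : Finset ι) {c : ℕ} (hT : T.card = c) : {i // i ∉ T} ⊕ Fin c ≃ ι :=
  ((Equiv.sumCongr (Equiv.refl _) (T.equivFinOfCardEq hT).symm).trans (Equiv.sumComm _ _)).trans
    (Equiv.sumCompl (· ∈ T))

theorem complSumEquiv_inr_mem (T : Finset ι) {c : ℕ} (hT : T.card = c) (j : Fin c) :
    complSumEquiv T hT (Sum.inr j) ∈ T := ((T.equivFinOfCardEq hT).symm j).2

/-- Puncturing a stabilizer code on coordinates inside an information set yields an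
entanglement-assisted code. -/
theorem exists_isEAQECC [DecidableEq K] (hK : Module.finrank F K = 2)
    (hβ : LinearIndependent F ![β, β ^ Fintype.card F]) (hC : C ≤ hermDual F C) {d : ℕ}
    (hd : IsDualDistance F C d) {T : Finset ι} {c : ℕ} (hTc : T.card = c)
    (hT : IsIndependentOn C T) :
    ∃ (S' : Subgroup (Matrix ({i // i ∉ T} → F) ({i // i ∉ T} → F) ℂ)ˣ)
      (Q' : Submodule ℂ (({i // i ∉ T} ⊕ Fin c → F) → ℂ)),
      IsEAQECC p S' Q' (Fintype.card ι - c) (Fintype.card ι - 2 * Module.finrank K C) d c ∧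
      tau p S' = codeLabels F β (puncture C T) ∧
      ((∃ x ∈ hermDual F C, x ∉ C ∧ hammingNorm x = d ∧ ∀ i ∈ T, x i = 0) →
        eaDist p Q' = d) := by
  let e := complSumEquiv T hTc
  let C₁ := C.map (LinearMap.funLeft K K e)
  have hC₁ : C₁ ≤ hermDual F C₁ := map_equiv_le_hermDual hC e
  have hd₁ : IsDualDistance F C₁ d := isDualDistance_map_equiv hd e
  -- The phases of a given stabilizer need not be transported: puncturing is up to phases, so any
  -- stabilizer group with the reordered labels will do.
  obtain ⟨S₁, hS₁, hSC₁⟩ := exists_isStabilizerGroup p (commutes_of_le_hermDual hβ p hK hC₁)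
  have hfin : Module.finrank K C₁ = Module.finrank K C :=
    (Submodule.equivMapOfInjective _ (LinearMap.funLeft_injective_of_surjective K K e
      e.surjective) C).symm.finrank_eq
  have hcard : Fintype.card ({i // i ∉ T} ⊕ Fin c) = Fintype.card ι := Fintype.card_congr e
  have hcT : Fintype.card {i // i ∉ T} + c = Fintype.card ι := by
    rw [← hcard, Fintype.card_sum, Fintype.card_fin]
  have hle : 2 * Module.finrank K C ≤ Fintype.card ι := by
    rw [← hfin, ← hcard]
    exact two_mul_finrank_le hK hβ hS₁ hSC₁
  have hI := finrank_puncture_inf_hermDual hK hC hT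
  have hP : C₁.map (LinearMap.funLeft K K Sum.inl) = puncture C T := by
    rw [← Submodule.map_comp, ← LinearMap.funLeft_comp]
    rfl
  have hdim : Module.finrank ℂ (fixedSpace S₁) =
      Fintype.card F ^ (Fintype.card ι - 2 * Module.finrank K C) := by
    rw [finrank_fixedSpace hK hβ hS₁ hSC₁, hcard, hfin]
  have hdist : (d : ℕ∞) ≤ eaDist p (fixedSpace S₁) := by
    refine le_iInf₂ fun v hv => ?_
    by_contra! h
    refine hv (detects_of_swt_lt hK hβ hSC₁ hd₁ ?_)
    rw [swt_onSender]
    exact_mod_cast h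
  have htau := tau_pauliPreimage p (codeLabels F β (puncture C T))
  refine ⟨pauliPreimage p (codeLabels F β (puncture C T)), fixedSpace S₁,
    { length := by omega
      ebits := Fintype.card_fin c
      le_pauli := pauliPreimage_le p _
      -- The radical of the punctured code has dimension `u - c` over `K`, and each such dimension
      -- contributes `q ^ 2` labels.
      params := ⟨2 * (Module.finrank K C - c), ?_, ?_, by omega⟩
      extension := ⟨S₁, hS₁, ?_, rfl⟩
      encoded := isEntanglementEncoded_of_annihilates (p := p) hdim ?_
      dim := hdim
      dist := hdist
      dist_zero := ?_ }, htau, ?_⟩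
  · have h : {v | v ∈ codeLabels F β (puncture C T) ∧
        ∀ w ∈ codeLabels F β (puncture C T), Commutes p v w} =
        (codeLabels F β (puncture C T ⊓ hermDual F (puncture C T)) :
          Set (({i // i ∉ T} → F) × ({i // i ∉ T} → F))) := by
      ext v
      rw [Set.mem_ofPred_eq, ← phi_mem_hermDual_iff hβ p hK]
      rfl
    rw [tau_isotropicPart_pauliPreimage, h, ncard_codeLabels hβ hK]
    congr 2
    omega
  · rw [htau, ncard_codeLabels hβ hK, finrank_puncture hK hC hT]
    congr 1
    omega
  · rw [IsPuncturing, htau, hSC₁, image_codeLabels hβ hK, hP]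
  · intro v hv
    refine annihilates_of_notMem_hermDual hK hβ hSC₁ fun h => hv ?_
    -- A receiver error in the dual would be a dual word supported on `T`, hence zero.
    obtain ⟨x, hx⟩ := exists_comp_equiv_eq e (phi F β (onReceiver {i // i ∉ T} v))
    rw [← hx, comp_equiv_mem_hermDual_iff] at h
    have hx0 : x = 0 := by
      refine hT.eq_zero_of_mem_hermDual hK h fun i hi => ?_
      have := congrFun hx (Sum.inl ⟨i, hi⟩)
      rw [Function.comp_apply, show e (Sum.inl ⟨i, hi⟩) = i from rfl] at this
      rw [this]
      simp [phi, onReceiver]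
    rw [← phi_eq_zero_iff hβ]
    ext j
    have := congrFun hx (Sum.inr j)
    rw [hx0] at this
    exact this.symm
  · intro _ v hv hvd
    refine annihilates_of_swt_lt hK hβ hSC₁ hd₁ (onSender_ne_zero hv) ?_
    rwa [swt_onSender]
  · rintro ⟨x, hx, hxC, hxd, hxT⟩
    refine le_antisymm ?_ hdist
    -- As `x` vanishes on `T`, it is the word of an error of weight `d` on the sender's qudits
    -- alone.
    obtain ⟨v, hv⟩ := (phi_bijective (ι := {i // i ∉ T}) hβ hK).2 (x ∘ Subtype.val)
    have hvx : phi F β (onSender (Fin c) v) = x ∘ e := by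
      ext i
      cases i with
      | inl i => exact congrFun hv i
      | inr j =>
        rw [Function.comp_apply, hxT _ (complSumEquiv_inr_mem T hTc j)]
        simp [phi, onSender]
    have hswt : swt v = d := by
      rw [← swt_onSender (κ := Fin c), ← hammingNorm_phi (K := K) hβ, hvx, hammingNorm_comp_equiv,
        hxd]
    rw [← hswt]
    refine iInf₂_le v (not_detects_of_mem_hermDual hK hβ hS₁ hSC₁ ?_ ?_)
    · rw [hvx]
      exact (comp_equiv_mem_hermDual_iff C e x).2 hx
    · rw [hvx]
      exact fun h => hxC ((comp_equiv_mem_map_iff C e x).1 h)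

end StabilizerCodes

end

end EAQ

theorem mainTheorem6
    {F K : Type*} [Field F] [Fintype F] [DecidableEq F] [Field K] [DecidableEq K] [Algebra F K]
    (p : ℕ) [Fact p.Prime] [Algebra (ZMod p) F]
    (hK : Module.finrank F K = 2)
    (β : K) (hβ : LinearIndependent F ![β, β ^ Fintype.card F])
    (N u d : ℕ) (C : Submodule K (Fin N → K))
    (hu : Module.finrank K C = u)
    (hself : C ≤ EAQ.hermDual F C)
    (hd : EAQ.IsDualDistance F C d) :
    (∃ S : Subgroup (Matrix (Fin N → F) (Fin N → F) ℂ)ˣ,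
      EAQ.IsStabilizerGroup p S ∧ EAQ.tau p S = {v | EAQ.phi F β v ∈ C}) ∧
    ∀ S : Subgroup (Matrix (Fin N → F) (Fin N → F) ℂ)ˣ,
      EAQ.IsStabilizerGroup p S → EAQ.tau p S = {v | EAQ.phi F β v ∈ C} →
      2 * u ≤ N ∧
      EAQ.IsQECC p (EAQ.fixedSpace S) N (N - 2 * u) d ∧
      EAQ.IsPureTo p S d ∧
      ((∃ x ∈ EAQ.hermDual F C, x ∉ C ∧ hammingNorm x = d) →
        EAQ.qDist p (EAQ.fixedSpace S) = d) ∧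
      ∀ c : ℕ, 0 < c → c ≤ u →
        ∃ (T : Finset (Fin N))
          (S' : Subgroup (Matrix ({i // i ∉ T} → F) ({i // i ∉ T} → F) ℂ)ˣ)
          (Q' : Submodule ℂ (({i // i ∉ T} ⊕ Fin c → F) → ℂ)),
          EAQ.IsEAQECC p S' Q' (N - c) (N - 2 * u) d c ∧
          EAQ.IsEquivalentQECC p S (EAQ.fixedSpace S) T S' Q' (N - c) (N - 2 * u) d c ∧
          EAQ.tau p S' = {v | EAQ.phi F β v ∈
            C.map (LinearMap.funLeft K K (Subtype.val : {i // i ∉ T} → Fin N))} ∧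
          ((∃ x ∈ EAQ.hermDual F C, x ∉ C ∧ hammingNorm x = d) → EAQ.eaDist p Q' = d) := by
  subst hu
  refine ⟨EAQ.exists_isStabilizerGroup p (EAQ.commutes_of_le_hermDual hβ p hK hself),
    fun S hS hSC => ?_⟩
  have hle := EAQ.two_mul_finrank_le hK hβ hS hSC
  have hQ := EAQ.isQECC_fixedSpace hK hβ hS hSC hd
  rw [Fintype.card_fin] at hle hQ
  refine ⟨hle, hQ, EAQ.isPureTo hK hβ hS hSC hd hself, EAQ.qDist_fixedSpace hK hβ hS hSC hd,
    fun c _ hc => ?_⟩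
  obtain ⟨T, hTc, hT, hTx⟩ := EAQ.exists_isIndependentOn_avoiding hd hself hc
  obtain ⟨S', Q', hQ', hS', hdist⟩ := EAQ.exists_isEAQECC (p := p) hK hβ hself hd hTc hT
  rw [Fintype.card_fin] at hQ'
  refine ⟨T, S', Q', hQ', ⟨hS, rfl, ?_, hQ', hTc, ?_⟩, hS', fun hx => hdist (hTx hx)⟩
  · rwa [Nat.sub_add_cancel (by omega)]
  · rw [EAQ.IsPuncturing, hS', hSC]
    exact (EAQ.image_codeLabels hβ hK C _).symm
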